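/- Let $\mu,\omega>0$. On the phase space of $(\phi,q,\Phi,Q)$ with $\Phi>0$ and conjugate pairs $(\phi,\Phi)$, $(q,Q)$, put $B=\sqrt{2\Phi/\omega}$, $A=2B$, $\sigma=(Q/\omega)/B$, $\chi=q/A$, $\Delta=\sqrt{1+3\cos^2\phi}$ and $$\rho(\phi,\sigma,\chi)=\sqrt{1+3\cos^2\phi+4\sigma\sin\phi+8\chi\cos\phi+4\sigma^2+4\chi^2}.$$ Order the terms by $\sigma=O(\chi^2)$: consider $$\mathcal K_\epsilon=\omega\Phi-\epsilon^4\Big(\tfrac32\omega^2B^2\sigma^2+\frac{\mu}{B}\,\frac1{\rho(\phi,\epsilon^2\sigma,\epsilon\chi)}\Big).$$ With $\omega x=2Q+\sqrt{2\omega\Phi}\sin\phi$, $\omega y=\omega q+2\sqrt{2\omega\Phi}\cos\phi$, $X=-\omega q-\sqrt{2\omega\Phi}\cos\phi$, $Y=-Q-\sqrt{2\omega\Phi}\sin\phi$, the function $\mathcal K_1$ is the planar Hill Hamiltonian $$\tfrac12(X+\omega y)^2+\tfrac12(Y-\omega x)^2-\tfrac32\omega^2x^2-\frac{\mu}{\sqrt{x^2+y^2}}.$$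 For small $\epsilon$ one has $\mathcal K_\epsilon=\sum_{m\ge0}\frac{\epsilon^m}{m!}K_{m,0}$ with $K_{0,0}=\omega\Phi$, $K_{m,0}=0$ for $0<m<4$, $K_{4,0}=-4!\big(\tfrac32\omega^2B^2\sigma^2+\frac{\mu}{B}\frac{S_0}{\Delta}\big)$ and $K_{m,0}=-\frac{\mu}{B}\frac{m!}{\Delta^{2(m-4)+1}}S_{m-4}$ for $m>4$, where $S_n/\Delta^{2n+1}$ is the $n$-th Taylor coefficient of $\epsilon\mapsto1/\rho(\phi,\epsilon^2\sigma,\epsilon\chi)$ at $\epsilon=0$. Here $S_0=1$, $S_1=-4\chi\cos\phi$ and $S_2=-\frac72\sigma\sin\phi-\frac32\sigma\sin3\phi+7\chi^2+9\chi^2\cos2\phi$. For smooth functions $W_1,W_2,\dots$ on the phase space, $2\pi$-periodic in $\phi$, define $K_{0,m}$ by Deprit's recursion $K_{n,k+1}=K_{n+1,k}+\sum_{m=0}^{n}\binom nm\{K_{n-m,k},W_{m+1}\}$. Apply the same recursion to each coordinate function $\xi\in\{\phi,q,\Phi,Q\}$ (starting from $\xi_{0,0}=\xi$ and $\xi_{n,0}=0$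 for $n\geq 1$) to obtain $\xi_{0,m}$ and the transformation $\mathcal T_\epsilon:\ \xi=\sum_{m=0}^{6}\frac{\epsilon^m}{m!}\xi_{0,m}(\phi',q',\Phi',Q')$. **(1) Normalization.** There is such a generator with $W_1=W_2=W_3=0$ for which $K_{0,0},\dots,K_{0,6}$ do not depend on $\phi'$. For every such generator, $\mathcal T_\epsilon$ is a near-identity transformation that is canonical up to $O(\epsilon^7)$ (its components satisfy the canonical Poisson bracket relations up to $O(\epsilon^7)$), and, locally uniformly on the phase space as $\epsilon\to0$, $$\mathcal K_\epsilon\circ\mathcal T_\epsilon=\sum_{m=0}^{6}\frac{\epsilon^m}{m!}K_{0,m}+O(\epsilon^7).$$ Moreover, for all $\epsilon$, $$\sum_{m=0}^{6}\frac{\epsilon^m}{m!}K_{0,m}=\omega\Phi'\Big[1-\epsilon^4\Big(3\sigma^2+\frac{2K(3/4)}{\pi}\frac{\mu}{\omega^2B^3}\Big)-\epsilon^6\,\frac{K(3/4)-E(3/4)}{(3/4)\pi}\frac{\mu}{\omega^2B^3}\chi^2\Big],$$ where $K(k^2)=\int_0^{\pi/2}(1-k^2\sin^2\theta)^{-1/2}d\theta$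 and $E(k^2)=\int_0^{\pi/2}(1-k^2\sin^2\theta)^{1/2}d\theta$ are the complete elliptic integrals, and $B,\sigma,\chi$ are evaluated at the new variables. At $\epsilon=1$ this is the normalized Hamiltonian $$\mathcal K'=\omega\Phi'\Big[1-3\sigma^2-\frac{2K(3/4)}{\pi}\frac{\mu}{\omega^2B^3}-\frac{K(3/4)-E(3/4)}{(3/4)\pi}\frac{\mu}{\omega^2B^3}\chi^2\Big].$$ **(2) Reduced flow.** Put $\tilde K=K(3/4)/\pi$, $\tilde E=E(3/4)/\pi$ and $\Omega=\sqrt{(\tilde K-\tilde E)\mu/B^3}$. Then $\Omega>0$ and $$\mathcal K'=\omega\Phi'\Big[1-3\sigma^2-\frac{\Omega^2}{\omega^2}\Big(\frac{2\tilde K}{\tilde K-\tilde E}+\frac43\chi^2\Big)\Big].$$ Hamilton's equations of $\mathcal K'$ read $\dot q'=-3Q'$, $\dot Q'=\frac13\Omega^2q'$, $\dot\Phi'=0$, $\dot\phi'=\partial\mathcal K'/\partial\Phi'$. Their unique solution on $\mathbb R$ with initial value $(\phi'_*,q'_*,\Phi',Q'_*)$, $\Phi'>0$, is, with $p_*=3Q'_*/\Omega$,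 $$q'=q'_*\cos\Omega t-p_*\sin\Omega t,\qquad Q'=Q'_*\cos\Omega t+\tfrac13q'_*\Omega\sin\Omega t,\qquad\Phi'=\text{const},$$ $$\phi'=\phi'_*+\omega(1+\delta)t+\frac{\Omega}{\omega}\frac{q_*'^2-p_*^2}{8B^2}\sin2\Omega t+\frac{\Omega}{\omega}\frac{q'_*p_*}{4B^2}(\cos2\Omega t-1),$$ $$\delta=\Big(\frac{\tilde K}{\tilde K-\tilde E}+\frac{q_*'^2+p_*^2}{4B^2}\Big)\frac{\Omega^2}{\omega^2}.$$ Thus $(q',Q')$ oscillates harmonically with frequency $\Omega$, and $\phi'$ grows at the rate $\omega(1+\delta)$ with a modulation of frequency $2\Omega$. -/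

import Mathlib

open Filter Topology Asymptotics
open scoped Real

namespace HillDRO

/-! ## Phase space and Hamiltonian formalism -/

/-- A point `z = (φ, q, Φ, Q)`: the coordinates `φ, q` and their conjugate momenta `Φ, Q`. -/
abbrev Phase := Fin 4 → ℝ

/-- The open set `Φ > 0` on which the coordinates `(φ, q, Φ, Q)` are regular. -/
def domain : Set Phase := {z | 0 < z 2}

/-- The partial derivative of `f` with respect to the `i`-th variable, at `z`. -/
noncomputable def partialD (i : Fin 4) (f : Phase → ℝ) (z : Phase) : ℝ :=
  deriv (fun t => f (Function.update z i t)) (z i)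

/-- The Poisson bracket for the conjugate pairs `(φ, Φ)` and `(q, Q)`. -/
noncomputable def poisson (f g : Phase → ℝ) (z : Phase) : ℝ :=
  (partialD 0 f z * partialD 2 g z - partialD 2 f z * partialD 0 g z)
    + (partialD 1 f z * partialD 3 g z - partialD 3 f z * partialD 1 g z)

/-- The right-hand side `(∂H/∂Φ, ∂H/∂Q, -∂H/∂φ, -∂H/∂q)` of Hamilton's equations. -/
noncomputable def hamVec (H : Phase → ℝ) (z : Phase) : Phase :=
  ![partialD 2 H z, partialD 3 H z, -partialD 0 H z, -partialD 1 H z]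

/-! ## The Lie-transform method of Deprit -/

/-- Deprit's triangle: `deprit f W n q` is the entry `f_{n,q}` generated by
`f_{n,q+1} = f_{n+1,q} + ∑_{m=0}^{n} (n choose m) {f_{n-m,q}, W_{m+1}}` from `f_{n,0} = f n`,
where `∑ εⁿ/n! f_{n,0}` is the transformed function and `∑ εᵐ/m! W_{m+1}` is the generating
function. The function in the new variables is `∑ εᵐ/m! f_{0,m}`. -/
noncomputable def deprit (f W : ℕ → Phase → ℝ) : ℕ → ℕ → Phase → ℝ
  | n, 0 => f n
  | n, q + 1 => fun z => deprit f W (n + 1) q z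
      + ∑ m ∈ Finset.range (n + 1),
          (n.choose m : ℝ) * poisson (deprit f W (n - m) q) (W (m + 1)) z

/-- The `i`-th coordinate function as a series in `ε` without terms of positive order. -/
def coordSeq (i : Fin 4) (n : ℕ) (z : Phase) : ℝ := if n = 0 then z i else 0

/-- The Lie transformation from new to old variables generated by `W`,
`ξ = ∑_{m ≤ M} εᵐ/m! ξ_{0,m}(z)`, truncated at order `M`. -/
noncomputable def lieTransform (W : ℕ → Phase → ℝ) (M : ℕ) (ε : ℝ) (z : Phase) : Phase :=
  fun i => ∑ m ∈ Finset.range (M + 1),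
    ε ^ m / (m.factorial : ℝ) * deprit (coordSeq i) W 0 m z

/-- The Hamiltonian in the new variables, `∑_{m ≤ M} εᵐ/m! K_{0,m}`, truncated at order `M`. -/
noncomputable def newHam (K W : ℕ → Phase → ℝ) (M : ℕ) (ε : ℝ) (z : Phase) : ℝ :=
  ∑ m ∈ Finset.range (M + 1), ε ^ m / (m.factorial : ℝ) * deprit K W 0 m z

/-! ## The planar Hill problem in the variables of the reference ellipse -/

/-- The Hamiltonian of the planar Hill problem in Cartesian canonical variables. -/
noncomputable def hillHam (μ ω x y X Y : ℝ) : ℝ :=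
  1 / 2 * (X + ω * y) ^ 2 + 1 / 2 * (Y - ω * x) ^ 2 - 3 / 2 * ω ^ 2 * x ^ 2
    - μ / √(x ^ 2 + y ^ 2)

/-- The Cartesian abscissa `x` as a function of `(φ, q, Φ, Q)`. -/
noncomputable def cartX (ω : ℝ) (z : Phase) : ℝ :=
  (2 * z 3 + √(2 * ω * z 2) * Real.sin (z 0)) / ω

/-- The Cartesian ordinate `y` as a function of `(φ, q, Φ, Q)`. -/
noncomputable def cartY (ω : ℝ) (z : Phase) : ℝ :=
  (ω * z 1 + 2 * √(2 * ω * z 2) * Real.cos (z 0)) / ω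

/-- The momentum `X` conjugate to `x` as a function of `(φ, q, Φ, Q)`. -/
noncomputable def cartPX (ω : ℝ) (z : Phase) : ℝ :=
  -ω * z 1 - √(2 * ω * z 2) * Real.cos (z 0)

/-- The momentum `Y` conjugate to `y` as a function of `(φ, q, Φ, Q)`. -/
noncomputable def cartPY (ω : ℝ) (z : Phase) : ℝ :=
  -z 3 - √(2 * ω * z 2) * Real.sin (z 0)

/-- Semi-minor axis `B` of the reference ellipse. -/
noncomputable def semiMinor (ω : ℝ) (z : Phase) : ℝ := √(2 * z 2 / ω)

/-- Semi-major axis `A` of the reference ellipse. -/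
noncomputable def semiMajor (ω : ℝ) (z : Phase) : ℝ := 2 * √(2 * z 2 / ω)

/-- The scaled abscissa `σ = (Q/ω)/B` of the centre of the reference ellipse. -/
noncomputable def sigma (ω : ℝ) (z : Phase) : ℝ := z 3 / ω / semiMinor ω z

/-- The scaled ordinate `χ = q/A` of the centre of the reference ellipse. -/
noncomputable def chi (ω : ℝ) (z : Phase) : ℝ := z 1 / semiMajor ω z

/-- The scaled distance to the origin, as a function of `φ`, `σ`, `χ`. -/
noncomputable def rho (φ σ χ : ℝ) : ℝ :=
  √(1 + 3 * Real.cos φ ^ 2 + 4 * σ * Real.sin φ + 8 * χ * Real.cos φ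
    + 4 * σ ^ 2 + 4 * χ ^ 2)

/-- `Δ = √(1 + 3 cos² φ)`. -/
noncomputable def Delta (φ : ℝ) : ℝ := √(1 + 3 * Real.cos φ ^ 2)

/-- The coefficients `S_n` of `1/ρ = ∑ S_n / Δ^(2n+1)`, where `S_n / Δ^(2n+1)` collects the terms
of order `n` when `χ` has order `1` and `σ` has order `2`: it is the `n`-th Taylor
coefficient at `ε = 0` of `ε ↦ 1/ρ(φ, ε²σ, εχ)`. -/
noncomputable def S (n : ℕ) (φ σ χ : ℝ) : ℝ :=
  Delta φ ^ (2 * n + 1)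
    * (iteratedDeriv n (fun ε : ℝ => 1 / rho φ (ε ^ 2 * σ) (ε * χ)) 0 / (n.factorial : ℝ))

/-- The Hamiltonian with the ordering parameter `ε`; at `ε = 1` it is the Hill Hamiltonian. -/
noncomputable def orderedHam (μ ω ε : ℝ) (z : Phase) : ℝ :=
  ω * z 2 - ε ^ 4 * (3 / 2 * ω ^ 2 * semiMinor ω z ^ 2 * sigma ω z ^ 2
    + μ / semiMinor ω z * (1 / rho (z 0) (ε ^ 2 * sigma ω z) (ε * chi ω z)))

/-- The terms `K_{m,0}` of the perturbation arrangement `∑ εᵐ/m! K_{m,0}`. -/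
noncomputable def hamTerm (μ ω : ℝ) (m : ℕ) (z : Phase) : ℝ :=
  if m = 0 then ω * z 2
  else if m < 4 then 0
  else if m = 4 then
    -(m.factorial : ℝ) * (3 / 2 * ω ^ 2 * semiMinor ω z ^ 2 * sigma ω z ^ 2
      + μ / semiMinor ω z * (S 0 (z 0) (sigma ω z) (chi ω z) / Delta (z 0)))
  else
    -(μ / semiMinor ω z) * ((m.factorial : ℝ) / Delta (z 0) ^ (2 * (m - 4) + 1))
      * S (m - 4) (z 0) (sigma ω z) (chi ω z)

/-- `W` generates a Lie transformation, smooth and `2π`-periodic in `φ` and starting at order four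
(as the perturbation does), that removes `φ` from the Hamiltonian through order six. -/
structure IsNormalizing (μ ω : ℝ) (W : ℕ → Phase → ℝ) : Prop where
  smooth : ∀ m, ContDiffOn ℝ ((⊤ : ℕ∞) : WithTop ℕ∞) (W m) domain
  periodic : ∀ m, ∀ z ∈ domain, W m (Function.update z 0 (z 0 + 2 * π)) = W m z
  low_order : ∀ m < 4, ∀ z ∈ domain, W m z = 0
  removes_angle : ∀ m ≤ 6, ∀ z ∈ domain, ∀ φ : ℝ,
    deprit (hamTerm μ ω) W 0 m (Function.update z 0 φ) = deprit (hamTerm μ ω) W 0 m z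

/-! ## The normalized Hamiltonian and its flow -/

/-- The complete elliptic integral of the first kind with parameter `m = k²`. -/
noncomputable def ellipticK (m : ℝ) : ℝ :=
  ∫ θ in (0 : ℝ)..(π / 2), 1 / √(1 - m * Real.sin θ ^ 2)

/-- The complete elliptic integral of the second kind with parameter `m = k²`. -/
noncomputable def ellipticE (m : ℝ) : ℝ :=
  ∫ θ in (0 : ℝ)..(π / 2), √(1 - m * Real.sin θ ^ 2)

/-- `K̃ = K(3/4)/π`. -/
noncomputable def Kt : ℝ := ellipticK (3 / 4) / π

/-- `Ẽ = E(3/4)/π`. -/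
noncomputable def Et : ℝ := ellipticE (3 / 4) / π

/-- The normalized Hamiltonian of sixth order. -/
noncomputable def normalizedHam (μ ω : ℝ) (z : Phase) : ℝ :=
  ω * z 2 * (1 - 3 * sigma ω z ^ 2
    - 2 * (ellipticK (3 / 4) / π) * (μ / (ω ^ 2 * semiMinor ω z ^ 3))
    - (ellipticK (3 / 4) - ellipticE (3 / 4)) / (3 / 4 * π)
        * (μ / (ω ^ 2 * semiMinor ω z ^ 3)) * chi ω z ^ 2)

/-- The libration frequency `Ω = √((K̃ - Ẽ) μ / B³)`. -/
noncomputable def libFreq (μ ω : ℝ) (z : Phase) : ℝ :=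
  √((Kt - Et) * (μ / semiMinor ω z ^ 3))

/-- The abbreviation `p_* = 3 Q_* / Ω`, at the initial point `z`. -/
noncomputable def pStar (μ ω : ℝ) (z : Phase) : ℝ := 3 * z 3 / libFreq μ ω z

/-- The relative correction `δ` of the phase rate, at the initial point `z`. -/
noncomputable def delta (μ ω : ℝ) (z : Phase) : ℝ :=
  (Kt / (Kt - Et) + (z 1 ^ 2 + pStar μ ω z ^ 2) / (4 * semiMinor ω z ^ 2))
    * (libFreq μ ω z ^ 2 / ω ^ 2)

/-- The explicit solution through the initial point `z = (φ_*, q_*, Φ, Q_*)`. -/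
noncomputable def solution (μ ω : ℝ) (z : Phase) (t : ℝ) : Phase :=
  let Ω := libFreq μ ω z
  let B := semiMinor ω z
  let p := pStar μ ω z
  ![z 0 + ω * (1 + delta μ ω z) * t
      + Ω / ω * ((z 1 ^ 2 - p ^ 2) / (8 * B ^ 2)) * Real.sin (2 * Ω * t)
      + Ω / ω * (z 1 * p / (4 * B ^ 2)) * (Real.cos (2 * Ω * t) - 1),
    z 1 * Real.cos (Ω * t) - p * Real.sin (Ω * t),
    z 2,
    z 3 * Real.cos (Ω * t) + z 1 * Ω / 3 * Real.sin (Ω * t)]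

end HillDRO

open HillDRO

/-!
The perturbation and the generator both start at order `ε⁴`, so through order six Deprit's
triangle is linear in the generator: `f_{0,m} = f_{m,0} + {f_{0,0}, W_m}` for `4 ≤ m ≤ 6`
(`deprit_succ_eq`). For the Hamiltonian this reads `K_{0,m} = K_{m,0} - ω ∂W_m/∂φ`. Hence a periodic
generator that removes `φ` forces `K_{0,m}` to be the mean of `K_{m,0}` over `φ`
(`deprit_eq_angleMean`), and conversely a primitive of the oscillating part of `K_{m,0}` is such a
generator (`isNormalizing_normalizingGen`). The means of the terms of order five and of the term in
`σ` of order six vanish because they change sign under `φ ↦ φ + π`; the remaining two are complete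
elliptic integrals, the one at order six after an integration by parts
(`hasDerivAt_elliptic_reduction`).

For the coordinates the same identity gives `T_ε = id + ε⁴ X_V` with the Hamiltonian vector field
`X_V` of `V = W_4/4! + ε W_5/5! + ε² W_6/6!` (`lieTransform_eq`). In the brackets of the components
the term in `ε⁴` vanishes by Jacobi's identity, so the defect is `O(ε⁸)`
(`poisson_lieTransform_isBigO`). The Hamiltonian is `ωΦ - ε⁴ G(ε, z)`; the displacement changes
`ωΦ` by exactly `-ε⁴ ω ∂V/∂φ` and `G`, which is locally Lipschitz, by `O(ε⁴)`, while the Taylor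
polynomial of `G` of degree two in `ε` has a locally uniform remainder `O(ε³)`
(`inv_rho_taylor_isBigO`). This yields `orderedHam_lieTransform_isBigO`.

The normalized Hamiltonian is independent of `φ` and quadratic in `(q, Q)`, so `Φ` is conserved,
`(q, Q)` is a harmonic oscillator and `φ` is obtained by a quadrature. Uniqueness of the solution
follows from the energy of the difference of two orbits (`orbit_unique`).
-/

namespace HillDRO

/-! ### Partial derivatives and Poisson brackets -/

lemma isOpen_domain : IsOpen domain :=
  isOpen_lt continuous_const (continuous_apply 2)

lemma domain_mem_nhds {z : Phase} (hz : z ∈ domain) : domain ∈ 𝓝 z :=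
  isOpen_domain.mem_nhds hz

lemma hasDerivAt_comp_update {f : Phase → ℝ} {f' : Phase →L[ℝ] ℝ} {z : Phase}
    (hf : HasFDerivAt f f' z) (i : Fin 4) :
    HasDerivAt (fun t => f (Function.update z i t)) (f' (Pi.single i 1)) (z i) := by
  have h := hasDerivAt_update z i (z i)
  have hf' : HasFDerivAt f f' (Function.update z i (z i)) := by simpa using hf
  exact hf'.comp_hasDerivAt (z i) h

lemma partialD_eq_fderiv {f : Phase → ℝ} {z : Phase} (hf : DifferentiableAt ℝ f z) (i : Fin 4) :
    partialD i f z = fderiv ℝ f z (Pi.single i 1) :=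
  (hasDerivAt_comp_update hf.hasFDerivAt i).deriv

lemma hasDerivAt_partialD {f : Phase → ℝ} {z : Phase} (hf : DifferentiableAt ℝ f z) (i : Fin 4) :
    HasDerivAt (fun t => f (Function.update z i t)) (partialD i f z) (z i) :=
  (hasDerivAt_comp_update hf.hasFDerivAt i).differentiableAt.hasDerivAt

lemma partialD_congr {f g : Phase → ℝ} {z : Phase} (h : f =ᶠ[𝓝 z] g) (i : Fin 4) :
    partialD i f z = partialD i g z := by
  have hc : Tendsto (fun t => Function.update z i t) (𝓝 (z i)) (𝓝 z) := by
    have : ContinuousAt (fun t => Function.update z i t) (z i) :=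
      (continuous_const.update i continuous_id).continuousAt
    simpa [ContinuousAt] using this
  exact Filter.EventuallyEq.deriv_eq (hc.eventually h)

lemma partialD_eq_zero {f : Phase → ℝ} {z : Phase} (h : f =ᶠ[𝓝 z] 0) (i : Fin 4) :
    partialD i f z = 0 := by
  rw [partialD_congr h]; simp [partialD]

lemma partialD_add {f g : Phase → ℝ} {z : Phase} (hf : DifferentiableAt ℝ f z)
    (hg : DifferentiableAt ℝ g z) (i : Fin 4) :
    partialD i (fun y => f y + g y) z = partialD i f z + partialD i g z :=
  ((hasDerivAt_partialD hf i).add (hasDerivAt_partialD hg i)).deriv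

lemma partialD_const_mul {f : Phase → ℝ} {z : Phase} (c : ℝ) (i : Fin 4) :
    partialD i (fun y => c * f y) z = c * partialD i f z :=
  deriv_const_mul_field c

lemma partialD_neg {f : Phase → ℝ} {z : Phase} (i : Fin 4) :
    partialD i (fun y => -f y) z = -partialD i f z := by
  simp [partialD]

lemma partialD_coord (i j : Fin 4) (z : Phase) :
    partialD i (fun y => y j) z = if i = j then 1 else 0 := by
  unfold partialD
  split_ifs with h
  · subst h; simp
  · have : (fun t => Function.update z i t j) = fun _ => z j := by
      funext t; simp [Function.update_of_ne (Ne.symm h)]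
    rw [this]; simp

/-- Real-valued functions that are infinitely differentiable on `Φ > 0`. -/
abbrev Smooth (f : Phase → ℝ) : Prop := ContDiffOn ℝ ((⊤ : ℕ∞) : WithTop ℕ∞) f domain

lemma Smooth.contDiffAt {f : Phase → ℝ} (hf : Smooth f) {z : Phase} (hz : z ∈ domain) :
    ContDiffAt ℝ ((⊤ : ℕ∞) : WithTop ℕ∞) f z :=
  ContDiffOn.contDiffAt hf (domain_mem_nhds hz)

lemma Smooth.differentiableAt {f : Phase → ℝ} (hf : Smooth f) {z : Phase} (hz : z ∈ domain) :
    DifferentiableAt ℝ f z :=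
  (hf.contDiffAt hz).differentiableAt (by simp)

lemma Smooth.continuousAt {f : Phase → ℝ} (hf : Smooth f) {z : Phase} (hz : z ∈ domain) :
    ContinuousAt f z :=
  (hf.contDiffAt hz).continuousAt

lemma Smooth.partialD {f : Phase → ℝ} (hf : Smooth f) (i : Fin 4) :
    Smooth (HillDRO.partialD i f) := by
  have h : Smooth (fun z => fderiv ℝ f z (Pi.single i 1)) :=
    (ContDiffOn.fderiv_of_isOpen hf isOpen_domain (by simp)).clm_apply contDiffOn_const
  exact h.congr fun z hz => partialD_eq_fderiv (hf.differentiableAt hz) i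

lemma partialD_comm {f : Phase → ℝ} (hf : Smooth f) {z : Phase} (hz : z ∈ domain) (i j : Fin 4) :
    partialD i (partialD j f) z = partialD j (partialD i f) z := by
  have hd : DifferentiableAt ℝ (fderiv ℝ f) z :=
    ((ContDiffOn.fderiv_of_isOpen hf isOpen_domain (m := ((⊤ : ℕ∞) : WithTop ℕ∞))
      (by simp)).contDiffAt (domain_mem_nhds hz)).differentiableAt (by simp)
  have key : ∀ k l : Fin 4, partialD k (partialD l f) z
      = fderiv ℝ (fderiv ℝ f) z (Pi.single k 1) (Pi.single l 1) := by
    intro k l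
    have he : partialD l f =ᶠ[𝓝 z] fun y => fderiv ℝ f y (Pi.single l 1) := by
      filter_upwards [domain_mem_nhds hz] with y hy
      exact partialD_eq_fderiv (hf.differentiableAt hy) l
    rw [partialD_congr he, partialD_eq_fderiv (hd.clm_apply (differentiableAt_const _)),
      fderiv_clm_apply hd (differentiableAt_const _)]
    simp
  have hs : IsSymmSndFDerivAt ℝ f z := by
    refine (hf.contDiffAt hz).isSymmSndFDerivAt ?_
    rw [minSmoothness_of_isRCLikeNormedField]
    exact WithTop.coe_le_coe.2 (le_top : (2 : ℕ∞) ≤ ⊤)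
  rw [key, key, hs]

lemma poisson_congr {f f' g g' : Phase → ℝ} {z : Phase} (hf : f =ᶠ[𝓝 z] f')
    (hg : g =ᶠ[𝓝 z] g') : poisson f g z = poisson f' g' z := by
  simp only [poisson, partialD_congr hf, partialD_congr hg]

lemma poisson_zero_left {f g : Phase → ℝ} {z : Phase} (hf : f =ᶠ[𝓝 z] 0) :
    poisson f g z = 0 := by
  simp [poisson, partialD_eq_zero hf]

lemma poisson_zero_right {f g : Phase → ℝ} {z : Phase} (hg : g =ᶠ[𝓝 z] 0) :
    poisson f g z = 0 := by
  simp [poisson, partialD_eq_zero hg]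

/-- The Hamiltonian vector field of `W` consists of the brackets of the coordinates with `W`. -/
lemma poisson_coord_left (W : Phase → ℝ) (z : Phase) (i : Fin 4) :
    poisson (fun y => y i) W z = hamVec W z i := by
  fin_cases i <;> simp [poisson, hamVec, partialD_coord]

/-! ### Deprit's triangle when the perturbation starts at order four -/

/-- If both the series and the generator start at order four (apart from `f 0`), no product of two
generating terms contributes below order eight, so each antidiagonal of the triangle is constant
after its first entry. -/
lemma deprit_succ_eq {f W : ℕ → Phase → ℝ}
    (hf : ∀ n, 0 < n → n < 4 → ∀ z ∈ domain, f n z = 0)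
    (hW : ∀ m < 4, ∀ z ∈ domain, W m z = 0) (q : ℕ) :
    ∀ n, n + (q + 1) ≤ 6 → ∀ z ∈ domain, deprit f W n (q + 1) z
      = f (n + (q + 1)) z + poisson (f 0) (W (n + (q + 1))) z := by
  have hW0 : ∀ m < 4, ∀ z ∈ domain, W m =ᶠ[𝓝 z] 0 := fun m hm z hz => by
    filter_upwards [domain_mem_nhds hz] with y hy using hW m hm y hy
  induction q with
  | zero =>
    intro n hn z hz
    simp only [deprit, zero_add]
    congr 1
    rw [Finset.sum_eq_single n]
    · simp
    · intro m hm hmn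
      have hm' : m < n := by have := Finset.mem_range.1 hm; omega
      -- A factor `W (m + 1)` of order below four vanishes; otherwise the other factor has an
      -- order strictly between zero and four.
      rcases lt_or_ge m 3 with h3 | h3
      · rw [poisson_zero_right (hW0 (m + 1) (by omega) z hz), mul_zero]
      · rw [poisson_zero_left, mul_zero]
        filter_upwards [domain_mem_nhds hz] with y hy
        exact hf (n - m) (by omega) (by omega) y hy
    · simp
  | succ q ih =>
    intro n hn z hz
    rw [deprit]
    beta_reduce
    rw [ih (n + 1) (by omega) z hz, Finset.sum_eq_zero, add_zero]
    · rw [show n + 1 + (q + 1) = n + (q + 1 + 1) by ring]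
    · intro m hm
      have hm' : m < n + 1 := Finset.mem_range.1 hm
      rcases lt_or_ge m 3 with h3 | h3
      · rw [poisson_zero_right (hW0 (m + 1) (by omega) z hz), mul_zero]
      · rw [poisson_zero_left, mul_zero]
        filter_upwards [domain_mem_nhds hz] with y hy
        rw [ih (n - m) (by omega) y hy, hf _ (by omega) (by omega) y hy,
          poisson_zero_right (hW0 _ (by omega) y hy)]
        simp

/-- The sum of a Deprit series through order six. -/
lemma sum_deprit_eq {f W : ℕ → Phase → ℝ}
    (hf : ∀ n, 0 < n → n < 4 → ∀ z ∈ domain, f n z = 0)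
    (hW : ∀ m < 4, ∀ z ∈ domain, W m z = 0) (ε : ℝ) {z : Phase} (hz : z ∈ domain) :
    ∑ m ∈ Finset.range (6 + 1), ε ^ m / (m.factorial : ℝ) * deprit f W 0 m z
      = f 0 z + ε ^ 4 * ((f 4 z + poisson (f 0) (W 4) z) / 24
        + ε * ((f 5 z + poisson (f 0) (W 5) z) / 120)
        + ε ^ 2 * ((f 6 z + poisson (f 0) (W 6) z) / 720)) := by
  have h : ∀ q, q + 1 ≤ 6 → deprit f W 0 (q + 1) z
      = f (q + 1) z + poisson (f 0) (W (q + 1)) z := fun q hq => by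
    simpa using deprit_succ_eq hf hW q 0 (by omega) z hz
  have hlow : ∀ q, q + 1 < 4 → deprit f W 0 (q + 1) z = 0 := fun q hq => by
    rw [h q (by omega), hf _ (by omega) hq z hz, poisson_zero_right, add_zero]
    filter_upwards [domain_mem_nhds hz] with y hy using hW _ hq y hy
  simp only [Finset.sum_range_succ, Finset.sum_range_zero, hlow 0 (by norm_num),
    hlow 1 (by norm_num), hlow 2 (by norm_num), h 3 (by norm_num), h 4 (by norm_num),
    h 5 (by norm_num)]
  simp only [deprit, Nat.factorial]
  push_cast
  ring

/-! ### The Lie transformation and its Poisson brackets -/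

/-- The sum `W_4/4! + ε W_5/5! + ε² W_6/6!`. For a generator `W` it is the function `V` whose
Hamiltonian vector field, multiplied by `ε⁴`, displaces the coordinates; it is also used with the
derivatives of `W` in place of `W`. -/
noncomputable def genSum (W : ℕ → Phase → ℝ) (ε : ℝ) (z : Phase) : ℝ :=
  W 4 z / 24 + ε * (W 5 z / 120) + ε ^ 2 * (W 6 z / 720)

lemma Smooth.genSum {W : ℕ → Phase → ℝ} (hW : ∀ m, Smooth (W m)) (ε : ℝ) :
    Smooth (HillDRO.genSum W ε) :=
  (((hW 4).div_const _).add (contDiffOn_const.mul ((hW 5).div_const _))).add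
    (contDiffOn_const.mul ((hW 6).div_const _))

lemma partialD_genSum {W : ℕ → Phase → ℝ} (hW : ∀ m, Smooth (W m)) (ε : ℝ) {z : Phase}
    (hz : z ∈ domain) (i : Fin 4) :
    partialD i (genSum W ε) z = genSum (fun m => partialD i (W m)) ε z := by
  have h := fun m => hasDerivAt_partialD ((hW m).differentiableAt hz) i
  exact ((((h 4).div_const 24).add (((h 5).div_const 120).const_mul ε)).add
    (((h 6).div_const 720).const_mul (ε ^ 2))).deriv

lemma continuousAt_genSum {W : ℕ → Phase → ℝ} (hW : ∀ m, Smooth (W m)) {z : Phase}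
    (hz : z ∈ domain) (ε : ℝ) :
    ContinuousAt (fun p : ℝ × Phase => genSum W p.1 p.2) (ε, z) := by
  have h : ∀ m, ContinuousAt (fun p : ℝ × Phase => W m p.2) (ε, z) := fun m =>
    ContinuousAt.comp (f := Prod.snd) ((hW m).continuousAt hz) continuousAt_snd
  unfold genSum
  exact (((h 4).div_const _).add (continuousAt_fst.mul ((h 5).div_const _))).add
    ((continuousAt_fst.pow 2).mul ((h 6).div_const _))

lemma hamVec_genSum {W : ℕ → Phase → ℝ} (hW : ∀ m, Smooth (W m)) (ε : ℝ) {z : Phase}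
    (hz : z ∈ domain) (i : Fin 4) :
    hamVec (genSum W ε) z i = genSum (fun m y => hamVec (W m) y i) ε z := by
  fin_cases i <;> simp [hamVec, partialD_genSum hW ε hz, genSum] <;> ring

lemma Smooth.hamVec {f : Phase → ℝ} (hf : Smooth f) (i : Fin 4) :
    Smooth (fun z => HillDRO.hamVec f z i) := by
  fin_cases i
  · exact hf.partialD 2
  · exact hf.partialD 3
  · exact (hf.partialD 0).neg
  · exact (hf.partialD 1).neg

lemma lieTransform_eq {W : ℕ → Phase → ℝ} (hW : ∀ m, Smooth (W m))
    (hlow : ∀ m < 4, ∀ z ∈ domain, W m z = 0) (ε : ℝ) {z : Phase} (hz : z ∈ domain) (i : Fin 4) :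
    lieTransform W 6 ε z i = z i + ε ^ 4 * hamVec (genSum W ε) z i := by
  have h0 : coordSeq i 0 = fun y => y i := by funext y; simp [coordSeq]
  unfold lieTransform
  rw [sum_deprit_eq (fun n hn _ y _ => by simp [coordSeq, hn.ne']) hlow ε hz,
    hamVec_genSum hW ε hz, h0]
  simp only [poisson_coord_left, genSum, coordSeq]
  norm_num

/-- Jacobi's identity for a bracket of two coordinates, which is constant. -/
lemma poisson_hamVec_add {V : Phase → ℝ} (hV : Smooth V) {z : Phase} (hz : z ∈ domain)
    (i j : Fin 4) :
    poisson (fun y => y i) (fun y => hamVec V y j) z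
      + poisson (fun y => hamVec V y i) (fun y => y j) z = 0 := by
  have e0 : (fun y => hamVec V y 0) = partialD 2 V := rfl
  have e1 : (fun y => hamVec V y 1) = partialD 3 V := rfl
  have e2 : (fun y => hamVec V y 2) = fun y => -partialD 0 V y := rfl
  have e3 : (fun y => hamVec V y 3) = fun y => -partialD 1 V y := rfl
  have c10 := partialD_comm hV hz 1 0
  have c20 := partialD_comm hV hz 2 0
  have c30 := partialD_comm hV hz 3 0
  have c21 := partialD_comm hV hz 2 1
  have c31 := partialD_comm hV hz 3 1
  have c32 := partialD_comm hV hz 3 2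
  fin_cases i <;> fin_cases j <;>
    simp [poisson, partialD_coord, e0, e1, e2, e3, partialD_neg] <;> linarith

lemma poisson_add_mul {a b u v : Phase → ℝ} {z : Phase} (ha : DifferentiableAt ℝ a z)
    (hb : DifferentiableAt ℝ b z) (hu : DifferentiableAt ℝ u z) (hv : DifferentiableAt ℝ v z)
    (c : ℝ) :
    poisson (fun y => a y + c * u y) (fun y => b y + c * v y) z
      = poisson a b z + c * (poisson a v z + poisson u b z) + c ^ 2 * poisson u v z := by
  simp only [poisson, partialD_add ha (hu.const_mul c), partialD_add hb (hv.const_mul c),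
    partialD_const_mul]
  ring

lemma continuousAt_partialD_hamVec_genSum {W : ℕ → Phase → ℝ} (hW : ∀ m, Smooth (W m))
    {z : Phase} (hz : z ∈ domain) (i k : Fin 4) (ε : ℝ) :
    ContinuousAt (fun p : ℝ × Phase => partialD k (fun y => hamVec (genSum W p.1) y i) p.2)
      (ε, z) := by
  have hc := continuousAt_genSum (W := fun m => partialD k fun y => hamVec (W m) y i)
    (fun m => ((hW m).hamVec i).partialD k) hz ε
  refine hc.congr ?_
  filter_upwards [continuousAt_snd.preimage_mem_nhds
    (domain_mem_nhds (z := ((ε, z) : ℝ × Phase).2) hz)] with p hp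
  have he : (fun y => hamVec (genSum W p.1) y i)
      =ᶠ[𝓝 p.2] genSum (fun m y => hamVec (W m) y i) p.1 := by
    filter_upwards [domain_mem_nhds hp] with y hy using hamVec_genSum hW p.1 hy i
  rw [partialD_congr he, partialD_genSum (fun m => (hW m).hamVec i) p.1 hp k]

/-- The terms of order `ε⁴` in the brackets of the transformed coordinates cancel by Jacobi's
identity, leaving only a term of order `ε⁸`. -/
lemma poisson_lieTransform_isBigO {W : ℕ → Phase → ℝ} (hW : ∀ m, Smooth (W m))
    (hlow : ∀ m < 4, ∀ z ∈ domain, W m z = 0) {z₀ : Phase} (hz₀ : z₀ ∈ domain) (i j : Fin 4) :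
    (fun p : ℝ × Phase =>
      poisson (fun z => lieTransform W 6 p.1 z i) (fun z => lieTransform W 6 p.1 z j) p.2
        - poisson (fun z => z i) (fun z => z j) p.2) =O[𝓝 ((0 : ℝ), z₀)] fun p => p.1 ^ 7 := by
  have heq : (fun p : ℝ × Phase =>
      poisson (fun z => lieTransform W 6 p.1 z i) (fun z => lieTransform W 6 p.1 z j) p.2
        - poisson (fun z => z i) (fun z => z j) p.2) =ᶠ[𝓝 ((0 : ℝ), z₀)]
      fun p => p.1 ^ 7 * (p.1 * poisson (fun y => hamVec (genSum W p.1) y i)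
        (fun y => hamVec (genSum W p.1) y j) p.2) := by
    filter_upwards [continuousAt_snd.preimage_mem_nhds
      (domain_mem_nhds (z := ((0, z₀) : ℝ × Phase).2) hz₀)] with p hp
    have hT : ∀ k, (fun z => lieTransform W 6 p.1 z k)
        =ᶠ[𝓝 p.2] fun z => z k + p.1 ^ 4 * hamVec (genSum W p.1) z k := fun k => by
      filter_upwards [domain_mem_nhds hp] with y hy using lieTransform_eq hW hlow p.1 hy k
    have hV := fun k => ((Smooth.genSum hW p.1).hamVec k).differentiableAt hp
    rw [poisson_congr (hT i) (hT j), poisson_add_mul (by fun_prop) (by fun_prop) (hV i) (hV j),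
      poisson_hamVec_add (Smooth.genSum hW p.1) hp]
    ring
  refine heq.trans_isBigO ?_
  have hc : ContinuousAt (fun p : ℝ × Phase => p.1 * poisson
      (fun y => hamVec (genSum W p.1) y i) (fun y => hamVec (genSum W p.1) y j) p.2) (0, z₀) := by
    have h := fun i k => continuousAt_partialD_hamVec_genSum hW hz₀ i k 0
    unfold poisson
    exact continuousAt_fst.mul ((((h i 0).mul (h j 2)).sub ((h i 2).mul (h j 0))).add
      (((h i 1).mul (h j 3)).sub ((h i 3).mul (h j 1))))
  simpa using (isBigO_refl (fun p : ℝ × Phase => p.1 ^ 7) (𝓝 ((0 : ℝ), z₀))).mul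
    (hc.isBigO_one ℝ)

/-! ### Expansion of the inverse distance -/

/-- The square of `rho φ (ε²σ) (εχ)`, as a polynomial in `ε`. -/
noncomputable def radicand (φ σ χ ε : ℝ) : ℝ :=
  1 + 3 * Real.cos φ ^ 2 + ε * (8 * χ * Real.cos φ)
    + ε ^ 2 * (4 * σ * Real.sin φ + 4 * χ ^ 2) + ε ^ 4 * (4 * σ ^ 2)

lemma rho_eq_sqrt_radicand (φ σ χ ε : ℝ) :
    rho φ (ε ^ 2 * σ) (ε * χ) = √(radicand φ σ χ ε) := by
  unfold rho radicand
  congr 1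
  ring

lemma Delta_pos (φ : ℝ) : 0 < Delta φ := Real.sqrt_pos.2 (by positivity)

lemma Delta_sq (φ : ℝ) : Delta φ ^ 2 = 1 + 3 * Real.cos φ ^ 2 :=
  Real.sq_sqrt (by positivity)

lemma radicand_zero (φ σ χ : ℝ) : radicand φ σ χ 0 = Delta φ ^ 2 := by
  rw [Delta_sq]; simp [radicand]

lemma contDiff_radicand (φ σ χ : ℝ) (n : WithTop ℕ∞) : ContDiff ℝ n (radicand φ σ χ) := by
  unfold radicand; fun_prop

lemma analyticAt_inv_rho (φ σ χ : ℝ) :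
    AnalyticAt ℝ (fun ε : ℝ => 1 / rho φ (ε ^ 2 * σ) (ε * χ)) 0 := by
  have h0 : radicand φ σ χ 0 ≠ 0 := by
    rw [radicand_zero]; exact (pow_pos (Delta_pos φ) 2).ne'
  simp only [rho_eq_sqrt_radicand]
  rw [← analyticWithinAt_univ, ← contDiffWithinAt_omega_iff_analyticWithinAt,
    contDiffWithinAt_univ]
  refine contDiffAt_const.div (((contDiff_radicand φ σ χ _).contDiffAt).sqrt h0) ?_
  rw [radicand_zero]
  exact (Real.sqrt_pos.2 (pow_pos (Delta_pos φ) 2)).ne'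

lemma S_div (n : ℕ) (φ σ χ : ℝ) : S n φ σ χ / Delta φ ^ (2 * n + 1)
    = iteratedDeriv n (fun ε : ℝ => 1 / rho φ (ε ^ 2 * σ) (ε * χ)) 0 / (n.factorial : ℝ) := by
  have := (Delta_pos φ).ne'
  unfold S
  rw [mul_div_cancel_left₀ _ (pow_ne_zero _ this)]

lemma hasSum_inv_rho (φ σ χ : ℝ) : ∀ᶠ ε in 𝓝 (0 : ℝ),
    HasSum (fun n : ℕ => ε ^ n * (S n φ σ χ / Delta φ ^ (2 * n + 1)))
      (1 / rho φ (ε ^ 2 * σ) (ε * χ)) := by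
  have h := hasFPowerSeriesAt_iff.1 (analyticAt_inv_rho φ σ χ).hasFPowerSeriesAt
  filter_upwards [h] with ε hε
  simpa [S_div, FormalMultilinearSeries.coeff_ofScalars] using hε

lemma hamTerm_zero (μ ω : ℝ) : hamTerm μ ω 0 = fun z => ω * z 2 := by
  funext z; simp [hamTerm]

lemma hamTerm_low (μ ω : ℝ) (n : ℕ) (h0 : 0 < n) (h4 : n < 4) (z : Phase) :
    hamTerm μ ω n z = 0 := by
  simp [hamTerm, h0.ne', h4]

lemma hasSum_orderedHam (μ ω : ℝ) (z : Phase) : ∀ᶠ ε in 𝓝 (0 : ℝ),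
    HasSum (fun m : ℕ => ε ^ m / (m.factorial : ℝ) * hamTerm μ ω m z) (orderedHam μ ω ε z) := by
  filter_upwards [hasSum_inv_rho (z 0) (sigma ω z) (chi ω z)] with ε hε
  rw [← hasSum_nat_add_iff' 4]
  have h1 := (hε.mul_left (μ / semiMinor ω z)).add
    (hasSum_ite_eq (0 : ℕ) (3 / 2 * ω ^ 2 * semiMinor ω z ^ 2 * sigma ω z ^ 2))
  have hterm : (fun n : ℕ => ε ^ (n + 4) / ((n + 4).factorial : ℝ) * hamTerm μ ω (n + 4) z)
      = fun n => -ε ^ 4 * (μ / semiMinor ω z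
          * (ε ^ n * (S n (z 0) (sigma ω z) (chi ω z) / Delta (z 0) ^ (2 * n + 1)))
        + if n = 0 then 3 / 2 * ω ^ 2 * semiMinor ω z ^ 2 * sigma ω z ^ 2 else 0) := by
    funext n
    have hf : ((n + 4).factorial : ℝ) ≠ 0 := by positivity
    rcases Nat.eq_zero_or_pos n with rfl | hn
    · simp only [hamTerm, zero_add, if_true]
      norm_num [Nat.factorial]
      ring
    · have h4 : ¬ (n + 4 < 4) := by omega
      have h4' : n + 4 ≠ 4 := by omega
      simp only [hamTerm, h4, h4', hn.ne', if_false, Nat.add_sub_cancel, add_zero,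
        show n + 4 ≠ 0 by omega]
      rw [pow_add]
      linear_combination (exp := 1) (-(μ / semiMinor ω z) * ε ^ n * ε ^ 4
        * S n (z 0) (sigma ω z) (chi ω z) / Delta (z 0) ^ (2 * n + 1)) * mul_inv_cancel₀ hf
  have hsum : orderedHam μ ω ε z
      - ∑ m ∈ Finset.range 4, ε ^ m / (m.factorial : ℝ) * hamTerm μ ω m z
      = -ε ^ 4 * (μ / semiMinor ω z * (1 / rho (z 0) (ε ^ 2 * sigma ω z) (ε * chi ω z))
        + 3 / 2 * ω ^ 2 * semiMinor ω z ^ 2 * sigma ω z ^ 2) := by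
    simp only [Finset.sum_range_succ, Finset.sum_range_zero, hamTerm_zero, orderedHam,
      hamTerm_low μ ω 1 (by norm_num) (by norm_num), hamTerm_low μ ω 2 (by norm_num) (by norm_num),
      hamTerm_low μ ω 3 (by norm_num) (by norm_num), Nat.factorial_zero, Nat.cast_one]
    ring
  rw [hterm, hsum]
  exact h1.mul_left (-ε ^ 4)

lemma hasDerivAt_radicand (φ σ χ ε : ℝ) : HasDerivAt (radicand φ σ χ)
    (8 * χ * Real.cos φ + 2 * ε * (4 * σ * Real.sin φ + 4 * χ ^ 2)
      + 4 * ε ^ 3 * (4 * σ ^ 2)) ε := by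
  have h1 := (hasDerivAt_id ε).mul_const (8 * χ * Real.cos φ)
  have h2 := (hasDerivAt_pow 2 ε).mul_const (4 * σ * Real.sin φ + 4 * χ ^ 2)
  have h4 := (hasDerivAt_pow 4 ε).mul_const (4 * σ ^ 2)
  refine HasDerivAt.congr_deriv (((h1.const_add (1 + 3 * Real.cos φ ^ 2)).add h2).add h4) ?_
  norm_num

lemma hasDerivAt_inv_sqrt {r : ℝ → ℝ} {r' x : ℝ} (hr : HasDerivAt r r' x) (h0 : 0 < r x) :
    HasDerivAt (fun y => 1 / √(r y)) (-(1 / 2) * r' * (1 / √(r x)) ^ 3) x := by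
  have hs : √(r x) ≠ 0 := (Real.sqrt_pos.2 h0).ne'
  have h := (hr.sqrt h0.ne').inv hs
  simp only [one_div]
  refine HasDerivAt.congr_deriv h ?_
  field_simp

lemma S_zero (φ σ χ : ℝ) : S 0 φ σ χ = 1 := by
  have := (Delta_pos φ).ne'
  simp [S]
  rw [show rho φ 0 0 = Delta φ by simp [rho, Delta]]
  field_simp

lemma deriv_inv_rho (φ σ χ : ℝ) :
    deriv (fun ε : ℝ => 1 / rho φ (ε ^ 2 * σ) (ε * χ)) =ᶠ[𝓝 0] fun ε => -(1 / 2)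
      * (8 * χ * Real.cos φ + 2 * ε * (4 * σ * Real.sin φ + 4 * χ ^ 2) + 4 * ε ^ 3 * (4 * σ ^ 2))
      * (1 / √(radicand φ σ χ ε)) ^ 3 := by
  have h0 : 0 < radicand φ σ χ 0 := by rw [radicand_zero]; exact pow_pos (Delta_pos φ) 2
  filter_upwards [(contDiff_radicand φ σ χ 0).continuous.continuousAt.eventually
    (lt_mem_nhds h0)] with ε hε
  simp only [rho_eq_sqrt_radicand]
  exact (hasDerivAt_inv_sqrt (hasDerivAt_radicand φ σ χ ε) hε).deriv

lemma S_one (φ σ χ : ℝ) : S 1 φ σ χ = -4 * χ * Real.cos φ := by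
  have := (Delta_pos φ).ne'
  simp only [S, iteratedDeriv_one, (deriv_inv_rho φ σ χ).eq_of_nhds, radicand_zero,
    Real.sqrt_sq (Delta_pos φ).le]
  simp
  field_simp
  ring

lemma S_two' (φ σ χ : ℝ) : S 2 φ σ χ = -(2 * σ * Real.sin φ + 2 * χ ^ 2) * Delta φ ^ 2
    + 24 * χ ^ 2 * Real.cos φ ^ 2 := by
  have hΔ := (Delta_pos φ).ne'
  have h0 : 0 < radicand φ σ χ 0 := by rw [radicand_zero]; exact pow_pos (Delta_pos φ) 2
  have hp : HasDerivAt (fun ε : ℝ => -(1 / 2) * (8 * χ * Real.cos φ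
      + 2 * ε * (4 * σ * Real.sin φ + 4 * χ ^ 2) + 4 * ε ^ 3 * (4 * σ ^ 2)))
      (-(4 * σ * Real.sin φ + 4 * χ ^ 2)) 0 := by
    have h1 := ((hasDerivAt_id (0 : ℝ)).const_mul 2).mul_const (4 * σ * Real.sin φ + 4 * χ ^ 2)
    have h3 := ((hasDerivAt_pow 3 (0 : ℝ)).const_mul 4).mul_const (4 * σ ^ 2)
    refine HasDerivAt.congr_deriv
      (((h1.const_add (8 * χ * Real.cos φ)).add h3).const_mul (-(1 / 2))) ?_
    norm_num
    ring
  have hd := hp.mul ((hasDerivAt_inv_sqrt (hasDerivAt_radicand φ σ χ 0) h0).pow 3)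
  have e : deriv (deriv (fun ε : ℝ => 1 / rho φ (ε ^ 2 * σ) (ε * χ))) 0 = _ :=
    (deriv_inv_rho φ σ χ).deriv_eq.trans hd.deriv
  simp only [S, iteratedDeriv_succ, iteratedDeriv_zero, e, Pi.pow_apply, radicand_zero,
    Real.sqrt_sq (Delta_pos φ).le, Nat.factorial]
  norm_num
  field_simp
  ring

lemma S_two (φ σ χ : ℝ) : S 2 φ σ χ = -(7 / 2) * σ * Real.sin φ - 3 / 2 * σ * Real.sin (3 * φ)
    + 7 * χ ^ 2 + 9 * χ ^ 2 * Real.cos (2 * φ) := by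
  rw [S_two', Delta_sq, Real.sin_three_mul, Real.cos_two_mul]
  have h : Real.cos φ ^ 2 = 1 - Real.sin φ ^ 2 := Real.cos_sq' φ
  rw [h]
  ring

lemma continuous_radicand :
    Continuous (fun p : ℝ × ℝ × ℝ × ℝ => radicand p.2.1 p.2.2.1 p.2.2.2 p.1) := by
  unfold radicand; fun_prop

lemma continuous_Delta : Continuous Delta := by
  unfold Delta; fun_prop

/-- The Taylor polynomial of `1/ρ` of degree two has a remainder `O(ε³)` that is locally uniform
in `φ, σ, χ`. With `N/Δ⁵` for the polynomial, `Δ¹⁰ - N²ρ²` is a polynomial divisible by `ε³`. -/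
lemma inv_rho_taylor_isBigO (φ₀ σ₀ χ₀ : ℝ) :
    (fun p : ℝ × ℝ × ℝ × ℝ => 1 / rho p.2.1 (p.1 ^ 2 * p.2.2.1) (p.1 * p.2.2.2)
      - (1 / Delta p.2.1 + p.1 * (S 1 p.2.1 p.2.2.1 p.2.2.2 / Delta p.2.1 ^ 3)
        + p.1 ^ 2 * (S 2 p.2.1 p.2.2.1 p.2.2.2 / Delta p.2.1 ^ 5)))
      =O[𝓝 (0, φ₀, σ₀, χ₀)] fun p => p.1 ^ 3 := by
  -- `ρ² = D + ε a + ε² b + ε⁴ d`, and `N = D² + ε n₁ + ε² n₂` is `D^{5/2}` times the truncated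
  -- expansion of its power `-1/2`; `R` collects what remains of `N² ρ² - D⁵ = ε³ R`.
  let a : ℝ × ℝ × ℝ × ℝ → ℝ := fun p => 8 * p.2.2.2 * Real.cos p.2.1
  let b : ℝ × ℝ × ℝ × ℝ → ℝ := fun p => 4 * p.2.2.1 * Real.sin p.2.1 + 4 * p.2.2.2 ^ 2
  let d : ℝ × ℝ × ℝ × ℝ → ℝ := fun p => 4 * p.2.2.1 ^ 2
  let D : ℝ × ℝ × ℝ × ℝ → ℝ := fun p => Delta p.2.1 ^ 2
  let n₁ : ℝ × ℝ × ℝ × ℝ → ℝ := fun p => -(a p * D p) / 2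
  let n₂ : ℝ × ℝ × ℝ × ℝ → ℝ := fun p => 3 / 8 * a p ^ 2 - b p * D p / 2
  let N : ℝ × ℝ × ℝ × ℝ → ℝ := fun p => D p ^ 2 + p.1 * n₁ p + p.1 ^ 2 * n₂ p
  let ρ : ℝ × ℝ × ℝ × ℝ → ℝ := fun p => √(radicand p.2.1 p.2.2.1 p.2.2.2 p.1)
  let R : ℝ × ℝ × ℝ × ℝ → ℝ := fun p =>
    (2 * n₁ p * n₂ p * D p + (n₁ p ^ 2 + 2 * D p ^ 2 * n₂ p) * a p + 2 * D p ^ 2 * n₁ p * b p)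
    + p.1 * (n₂ p ^ 2 * D p + 2 * n₁ p * n₂ p * a p + (n₁ p ^ 2 + 2 * D p ^ 2 * n₂ p) * b p
      + D p ^ 4 * d p)
    + p.1 ^ 2 * (n₂ p ^ 2 * a p + 2 * n₁ p * n₂ p * b p + 2 * D p ^ 2 * n₁ p * d p)
    + p.1 ^ 3 * (n₂ p ^ 2 * b p + (n₁ p ^ 2 + 2 * D p ^ 2 * n₂ p) * d p)
    + p.1 ^ 4 * (2 * n₁ p * n₂ p * d p) + p.1 ^ 5 * (n₂ p ^ 2 * d p)
  let M : ℝ × ℝ × ℝ × ℝ → ℝ := fun p =>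
    ρ p * Delta p.2.1 ^ 5 * (Delta p.2.1 ^ 5 + N p * ρ p)
  have hD : Continuous fun p : ℝ × ℝ × ℝ × ℝ => Delta p.2.1 :=
    continuous_Delta.comp (by fun_prop)
  have hDc : Continuous D := hD.pow 2
  have ha : Continuous a := by fun_prop
  have hb : Continuous b := by fun_prop
  have hdc : Continuous d := by fun_prop
  have hn₁ : Continuous n₁ := by fun_prop
  have hn₂ : Continuous n₂ := by fun_prop
  have hN : Continuous N := by fun_prop
  have hρ : Continuous ρ := Real.continuous_sqrt.comp continuous_radicand
  have hR : Continuous R := by fun_prop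
  have hM : Continuous M := by fun_prop
  have hΔ := Delta_pos φ₀
  have hρ0 : ρ (0, φ₀, σ₀, χ₀) = Delta φ₀ := by
    simp [ρ, radicand_zero, Real.sqrt_sq hΔ.le]
  have hM0 : M (0, φ₀, σ₀, χ₀) ≠ 0 := by
    simp only [M, hρ0, N, D, zero_mul, add_zero, zero_pow two_ne_zero]
    positivity
  have heq : (fun p : ℝ × ℝ × ℝ × ℝ => 1 / rho p.2.1 (p.1 ^ 2 * p.2.2.1) (p.1 * p.2.2.2)
      - (1 / Delta p.2.1 + p.1 * (S 1 p.2.1 p.2.2.1 p.2.2.2 / Delta p.2.1 ^ 3)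
        + p.1 ^ 2 * (S 2 p.2.1 p.2.2.1 p.2.2.2 / Delta p.2.1 ^ 5)))
      =ᶠ[𝓝 (0, φ₀, σ₀, χ₀)] fun p => p.1 ^ 3 * (-R p / M p) := by
    filter_upwards [hM.continuousAt.eventually_ne hM0, hρ.continuousAt.eventually_ne
      (by rw [hρ0]; exact hΔ.ne')] with p hp hρp
    have hΔp := (Delta_pos p.2.1).ne'
    have hpoly : 1 / Delta p.2.1 + p.1 * (S 1 p.2.1 p.2.2.1 p.2.2.2 / Delta p.2.1 ^ 3)
        + p.1 ^ 2 * (S 2 p.2.1 p.2.2.1 p.2.2.2 / Delta p.2.1 ^ 5) = N p / Delta p.2.1 ^ 5 := by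
      rw [S_one, S_two']
      simp only [N, n₁, n₂, D, a, b]
      field_simp
      ring
    have hsq : ρ p ^ 2 = D p + p.1 * a p + p.1 ^ 2 * b p + p.1 ^ 4 * d p := by
      have hpos : 0 ≤ radicand p.2.1 p.2.2.1 p.2.2.2 p.1 := by
        by_contra hneg
        exact hρp (Real.sqrt_eq_zero_of_nonpos (not_le.1 hneg).le)
      simp only [ρ]
      rw [Real.sq_sqrt hpos]
      simp only [D, Delta_sq, a, b, d, radicand]
    have hkey : Delta p.2.1 ^ 10 - N p ^ 2 * ρ p ^ 2 = -p.1 ^ 3 * R p := by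
      rw [hsq, show Delta p.2.1 ^ 10 = D p ^ 5 by simp only [D]; ring]
      simp only [R, N, n₁, n₂]
      ring
    rw [rho_eq_sqrt_radicand, hpoly]
    change 1 / ρ p - N p / Delta p.2.1 ^ 5 = p.1 ^ 3 * (-R p / M p)
    -- Rationalize the difference of the two quotients.
    have hM' : Delta p.2.1 ^ 5 + N p * ρ p ≠ 0 := right_ne_zero_of_mul hp
    rw [mul_div_assoc', eq_div_iff hp, mul_neg, ← neg_mul, ← hkey]
    simp only [M]
    field_simp
    ring
  refine heq.trans_isBigO ?_
  have hc : ContinuousAt (fun p => -R p / M p) (0, φ₀, σ₀, χ₀) :=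
    hR.continuousAt.neg.div hM.continuousAt hM0
  simpa using (isBigO_refl (fun p : ℝ × ℝ × ℝ × ℝ => p.1 ^ 3) _).mul (hc.isBigO_one ℝ)

/-! ### Averages over the angle -/

/-- The mean of a function over `[0, 2π]`. -/
noncomputable def angleMean (g : ℝ → ℝ) : ℝ := (∫ s in (0 : ℝ)..2 * π, g s) / (2 * π)

/-- The primitive, vanishing at `0`, of the oscillating part of `g`. -/
noncomputable def oscPrimitive (g : ℝ → ℝ) (φ : ℝ) : ℝ :=
  ∫ s in (0 : ℝ)..φ, (g s - angleMean g)

lemma hasDerivAt_oscPrimitive {g : ℝ → ℝ} (hg : Continuous g) (φ : ℝ) :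
    HasDerivAt (oscPrimitive g) (g φ - angleMean g) φ :=
  (hg.sub continuous_const).integral_hasStrictDerivAt 0 φ |>.hasDerivAt

lemma contDiff_oscPrimitive {g : ℝ → ℝ} (hg : ContDiff ℝ ((⊤ : ℕ∞) : WithTop ℕ∞) g) :
    ContDiff ℝ ((⊤ : ℕ∞) : WithTop ℕ∞) (oscPrimitive g) := by
  have hd := hasDerivAt_oscPrimitive hg.continuous
  rw [contDiff_infty_iff_deriv]
  refine ⟨fun φ => (hd φ).differentiableAt, ?_⟩
  rw [show deriv (oscPrimitive g) = fun φ => g φ - angleMean g from funext fun φ => (hd φ).deriv]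
  exact hg.sub contDiff_const

lemma oscPrimitive_periodic {g : ℝ → ℝ} (hg : Continuous g) (hp : Function.Periodic g (2 * π))
    (φ : ℝ) : oscPrimitive g (φ + 2 * π) = oscPrimitive g φ := by
  have hc : Continuous fun s => g s - angleMean g := hg.sub continuous_const
  have hper : Function.Periodic (fun s => g s - angleMean g) (2 * π) := fun s => by
    simp only [hp s]
  have h2 : ∫ s in φ..φ + 2 * π, (g s - angleMean g) = 0 := by
    rw [hper.intervalIntegral_add_eq φ 0, zero_add,
      intervalIntegral.integral_sub (hg.intervalIntegrable _ _) (by simp)]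
    simp only [intervalIntegral.integral_const, sub_zero, smul_eq_mul, angleMean]
    rw [mul_div_cancel₀ _ Real.two_pi_pos.ne', sub_self]
  rw [oscPrimitive, ← intervalIntegral.integral_add_adjacent_intervals
    (hc.intervalIntegrable 0 φ) (hc.intervalIntegrable φ _), h2, add_zero, oscPrimitive]

lemma angleMean_comb {g h : ℝ → ℝ} (hg : Continuous g) (hh : Continuous h) (a b c : ℝ) :
    angleMean (fun φ => a + b * g φ + c * h φ) = a + b * angleMean g + c * angleMean h := by
  have hπ := Real.pi_pos.ne'
  have h1 : Continuous fun φ => b * g φ := hg.const_mul b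
  have h2 : Continuous fun φ => c * h φ := hh.const_mul c
  have h0 : Continuous fun φ => a + b * g φ := continuous_const.add h1
  simp only [angleMean]
  rw [intervalIntegral.integral_add (h0.intervalIntegrable _ _)
    (h2.intervalIntegrable _ _), intervalIntegral.integral_add (by simp)
    (h1.intervalIntegrable _ _), intervalIntegral.integral_const_mul,
    intervalIntegral.integral_const_mul, intervalIntegral.integral_const]
  simp only [smul_eq_mul]
  field_simp
  ring

lemma angleMean_eq_zero {g : ℝ → ℝ} (hg : Continuous g) (h : ∀ φ, g (φ + π) = -g φ) :
    angleMean g = 0 := by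
  have h1 : ∫ s in (0 : ℝ)..π, g (s + π) = ∫ s in π..2 * π, g s := by
    rw [intervalIntegral.integral_comp_add_right]; congr 1 <;> ring
  simp only [h, intervalIntegral.integral_neg] at h1
  rw [angleMean, ← intervalIntegral.integral_add_adjacent_intervals
    (hg.intervalIntegrable 0 π) (hg.intervalIntegrable π _), ← h1]
  simp

lemma angleMean_eq_quarter {g : ℝ → ℝ} (hg : Continuous g) (h : ∀ φ, g (φ + π) = g φ)
    (h' : ∀ φ, g (π - φ) = g φ) : angleMean g = 2 / π * ∫ s in (0 : ℝ)..π / 2, g s := by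
  have h1 : ∫ s in (0 : ℝ)..π, g (s + π) = ∫ s in π..2 * π, g s := by
    rw [intervalIntegral.integral_comp_add_right]; congr 1 <;> ring
  have h2 : ∫ s in (0 : ℝ)..π / 2, g (π - s) = ∫ s in π / 2..π, g s := by
    rw [intervalIntegral.integral_comp_sub_left]; congr 1 <;> ring
  simp only [h] at h1
  simp only [h'] at h2
  rw [angleMean, ← intervalIntegral.integral_add_adjacent_intervals
    (hg.intervalIntegrable 0 π) (hg.intervalIntegrable π _), ← h1,
    ← intervalIntegral.integral_add_adjacent_intervals
    (hg.intervalIntegrable 0 (π / 2)) (hg.intervalIntegrable _ π), ← h2]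
  have hπ := Real.pi_pos.ne'
  field_simp
  ring

lemma contDiff_Delta : ContDiff ℝ ((⊤ : ℕ∞) : WithTop ℕ∞) Delta := by
  have h : ContDiff ℝ ((⊤ : ℕ∞) : WithTop ℕ∞) fun φ => 1 + 3 * Real.cos φ ^ 2 :=
    contDiff_const.add (contDiff_const.mul (Real.contDiff_cos.pow 2))
  exact h.sqrt fun φ => by positivity

lemma Delta_add_pi (φ : ℝ) : Delta (φ + π) = Delta φ := by
  simp [Delta, Real.cos_add_pi]

lemma Delta_pi_sub (φ : ℝ) : Delta (π - φ) = Delta φ := by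
  simp [Delta, Real.cos_pi_sub]

lemma Delta_add_two_pi (φ : ℝ) : Delta (φ + 2 * π) = Delta φ := by
  simp [Delta, Real.cos_add_two_pi]

lemma Delta_eq (φ : ℝ) : Delta φ = 2 * √(1 - 3 / 4 * Real.sin φ ^ 2) := by
  rw [Delta, show 1 + 3 * Real.cos φ ^ 2 = 2 ^ 2 * (1 - 3 / 4 * Real.sin φ ^ 2) by
    rw [Real.cos_sq']; ring, Real.sqrt_mul (by norm_num), Real.sqrt_sq (by norm_num)]

/-- The dependence on the angle of the term of order four. -/
noncomputable def angleFour (φ : ℝ) : ℝ := 1 / Delta φ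

/-- The dependence on the angle of the term of order five. -/
noncomputable def angleFive (φ : ℝ) : ℝ := Real.cos φ / Delta φ ^ 3

/-- The dependence on the angle of the coefficient of `σ` in the term of order six. -/
noncomputable def angleSixσ (φ : ℝ) : ℝ :=
  (-(7 / 2) * Real.sin φ - 3 / 2 * Real.sin (3 * φ)) / Delta φ ^ 5

/-- The dependence on the angle of the coefficient of `χ²` in the term of order six. -/
noncomputable def angleSixχ (φ : ℝ) : ℝ := (7 + 9 * Real.cos (2 * φ)) / Delta φ ^ 5

lemma contDiff_angleFour : ContDiff ℝ ((⊤ : ℕ∞) : WithTop ℕ∞) angleFour :=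
  contDiff_const.div contDiff_Delta fun φ => (Delta_pos φ).ne'

lemma contDiff_angleFive : ContDiff ℝ ((⊤ : ℕ∞) : WithTop ℕ∞) angleFive :=
  Real.contDiff_cos.div (contDiff_Delta.pow 3) fun φ => (pow_pos (Delta_pos φ) 3).ne'

lemma contDiff_angleSixσ : ContDiff ℝ ((⊤ : ℕ∞) : WithTop ℕ∞) angleSixσ :=
  ((contDiff_const.mul Real.contDiff_sin).sub
    (contDiff_const.mul (Real.contDiff_sin.comp (contDiff_const.mul contDiff_id)))).div
    (contDiff_Delta.pow 5) fun φ => (pow_pos (Delta_pos φ) 5).ne'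

lemma contDiff_angleSixχ : ContDiff ℝ ((⊤ : ℕ∞) : WithTop ℕ∞) angleSixχ :=
  (contDiff_const.add
    (contDiff_const.mul (Real.contDiff_cos.comp (contDiff_const.mul contDiff_id)))).div
    (contDiff_Delta.pow 5) fun φ => (pow_pos (Delta_pos φ) 5).ne'

lemma periodic_angleFour : Function.Periodic angleFour (2 * π) := fun φ => by
  simp [angleFour, Delta_add_two_pi]

lemma periodic_angleFive : Function.Periodic angleFive (2 * π) := fun φ => by
  simp [angleFive, Delta_add_two_pi]

lemma periodic_angleSixσ : Function.Periodic angleSixσ (2 * π) := fun φ => by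
  have h : Real.sin (3 * (φ + 2 * π)) = Real.sin (3 * φ) := by
    simp [Real.sin_three_mul]
  simp [angleSixσ, Delta_add_two_pi, h]

lemma periodic_angleSixχ : Function.Periodic angleSixχ (2 * π) := fun φ => by
  simp [angleSixχ, Delta_add_two_pi, Real.cos_two_mul]

lemma angleMean_angleFour : angleMean angleFour = ellipticK (3 / 4) / π := by
  rw [angleMean_eq_quarter contDiff_angleFour.continuous
    (fun φ => by simp [angleFour, Delta_add_pi]) (fun φ => by simp [angleFour, Delta_pi_sub])]
  have h : angleFour = fun φ => 1 / 2 * (1 / √(1 - 3 / 4 * Real.sin φ ^ 2)) := by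
    funext φ; rw [angleFour, Delta_eq]; ring
  rw [h, intervalIntegral.integral_const_mul, ellipticK]
  ring

lemma angleMean_angleFive : angleMean angleFive = 0 :=
  angleMean_eq_zero contDiff_angleFive.continuous fun φ => by
    simp [angleFive, Delta_add_pi, Real.cos_add_pi, neg_div]

lemma angleMean_angleSixσ : angleMean angleSixσ = 0 :=
  angleMean_eq_zero contDiff_angleSixσ.continuous fun φ => by
    simp only [angleSixσ, Delta_add_pi, Real.sin_add_pi, Real.sin_three_mul]
    ring

lemma hasDerivAt_Delta (φ : ℝ) :
    HasDerivAt Delta (-(3 * Real.sin φ * Real.cos φ) / Delta φ) φ := by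
  have h : HasDerivAt (fun φ => 1 + 3 * Real.cos φ ^ 2) (-(6 * Real.sin φ * Real.cos φ)) φ :=
    ((((Real.hasDerivAt_cos φ).pow 2).const_mul 3).const_add 1).congr_deriv (by
      norm_num; ring)
  refine (h.sqrt (by positivity)).congr_deriv ?_
  change _ / (2 * Delta φ) = _
  have := (Delta_pos φ).ne'
  field_simp
  ring

/-- The primitive that reduces the average of the term in `χ²` to complete elliptic integrals of
the first and second kind. -/
lemma hasDerivAt_elliptic_reduction (φ : ℝ) :
    HasDerivAt (fun φ => Real.sin φ * Real.cos φ * (6 / Delta φ ^ 3 + 3 / (2 * Delta φ)))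
      (3 * angleSixχ φ
        - (1 / √(1 - 3 / 4 * Real.sin φ ^ 2) - √(1 - 3 / 4 * Real.sin φ ^ 2))) φ := by
  have hΔ := (Delta_pos φ).ne'
  have hd := hasDerivAt_Delta φ
  have h3 := (hasDerivAt_const φ (6 : ℝ)).div (hd.pow 3) (pow_ne_zero 3 hΔ)
  have h1 := (hasDerivAt_const φ (3 : ℝ)).div (hd.const_mul 2) (mul_ne_zero two_ne_zero hΔ)
  refine (((Real.hasDerivAt_sin φ).mul (Real.hasDerivAt_cos φ)).mul (h3.add h1)).congr_deriv ?_
  have hs : √(1 - 3 / 4 * Real.sin φ ^ 2) = Delta φ / 2 := by rw [Delta_eq]; ring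
  have hc : Real.cos φ ^ 2 = (Delta φ ^ 2 - 1) / 3 := by rw [Delta_sq]; ring
  have hs2 : Real.sin φ ^ 2 = (4 - Delta φ ^ 2) / 3 := by rw [Real.sin_sq, hc]; ring
  simp only [Pi.mul_apply, Pi.add_apply, Pi.div_apply, Pi.pow_apply, angleSixχ,
    Real.cos_two_mul, hs]
  field_simp
  norm_num
  ring_nf
  rw [hc, hs2]
  ring

lemma sqrt_one_sub_pos (φ : ℝ) : 0 < √(1 - 3 / 4 * Real.sin φ ^ 2) :=
  Real.sqrt_pos.2 (by nlinarith [Real.sin_sq_add_cos_sq φ, sq_nonneg (Real.cos φ)])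

lemma continuous_sqrt_one_sub : Continuous fun φ => √(1 - 3 / 4 * Real.sin φ ^ 2) := by
  fun_prop

lemma ellipticK_sub_ellipticE : ellipticK (3 / 4) - ellipticE (3 / 4)
    = ∫ φ in (0 : ℝ)..π / 2,
      (1 / √(1 - 3 / 4 * Real.sin φ ^ 2) - √(1 - 3 / 4 * Real.sin φ ^ 2)) := by
  have hc := continuous_sqrt_one_sub
  have hi : Continuous fun φ => 1 / √(1 - 3 / 4 * Real.sin φ ^ 2) :=
    continuous_const.div hc fun φ => (sqrt_one_sub_pos φ).ne'
  rw [intervalIntegral.integral_sub (hi.intervalIntegrable _ _) (hc.intervalIntegrable _ _)]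
  rfl

lemma continuous_elliptic_diff : Continuous fun φ =>
    1 / √(1 - 3 / 4 * Real.sin φ ^ 2) - √(1 - 3 / 4 * Real.sin φ ^ 2) :=
  (continuous_const.div continuous_sqrt_one_sub fun φ => (sqrt_one_sub_pos φ).ne').sub
    continuous_sqrt_one_sub

lemma ellipticE_lt_ellipticK : ellipticE (3 / 4) < ellipticK (3 / 4) := by
  rw [← sub_pos, ellipticK_sub_ellipticE]
  refine intervalIntegral.intervalIntegral_pos_of_pos_on
    (continuous_elliptic_diff.intervalIntegrable _ _) (fun φ hφ => ?_) (by positivity)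
  have hsin : 0 < Real.sin φ := Real.sin_pos_of_pos_of_lt_pi hφ.1 (by linarith [hφ.2, Real.pi_pos])
  have hlt : √(1 - 3 / 4 * Real.sin φ ^ 2) < 1 := by
    rw [Real.sqrt_lt' one_pos]; nlinarith [pow_pos hsin 2]
  have h1 : 1 < 1 / √(1 - 3 / 4 * Real.sin φ ^ 2) := by
    rwa [lt_div_iff₀ (sqrt_one_sub_pos φ), one_mul]
  linarith

lemma angleMean_angleSixχ :
    angleMean angleSixχ = 2 * (ellipticK (3 / 4) - ellipticE (3 / 4)) / (3 * π) := by
  have hcont := contDiff_angleSixχ.continuous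
  rw [angleMean_eq_quarter hcont
    (fun φ => by simp only [angleSixχ, Delta_add_pi, Real.cos_two_mul, Real.cos_add_pi, neg_sq])
    (fun φ => by simp only [angleSixχ, Delta_pi_sub, Real.cos_two_mul, Real.cos_pi_sub, neg_sq])]
  have h := intervalIntegral.integral_eq_sub_of_hasDerivAt (a := 0) (b := π / 2)
    (fun φ _ => hasDerivAt_elliptic_reduction φ)
    (((hcont.const_mul 3).sub continuous_elliptic_diff).intervalIntegrable _ _)
  rw [intervalIntegral.integral_sub ((hcont.const_mul 3).intervalIntegrable _ _)
    (continuous_elliptic_diff.intervalIntegrable _ _), intervalIntegral.integral_const_mul,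
    ← ellipticK_sub_ellipticE] at h
  simp only [Real.cos_pi_div_two, Real.sin_zero, mul_zero, zero_mul, sub_zero] at h
  have hπ := Real.pi_pos.ne'
  field_simp
  linarith

/-! ### The normalization -/

lemma update_mem_domain {z : Phase} (hz : z ∈ domain) (φ : ℝ) :
    Function.update z 0 φ ∈ domain := by
  simpa [domain, Function.update_of_ne] using hz

lemma semiMinor_update (ω : ℝ) (z : Phase) (φ : ℝ) :
    semiMinor ω (Function.update z 0 φ) = semiMinor ω z := by
  simp [semiMinor]

lemma sigma_update (ω : ℝ) (z : Phase) (φ : ℝ) :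
    sigma ω (Function.update z 0 φ) = sigma ω z := by
  simp [sigma, semiMinor_update]

lemma chi_update (ω : ℝ) (z : Phase) (φ : ℝ) :
    chi ω (Function.update z 0 φ) = chi ω z := by
  simp [chi, semiMajor]

lemma semiMinor_pos {ω : ℝ} (hω : 0 < ω) {z : Phase} (hz : z ∈ domain) : 0 < semiMinor ω z :=
  Real.sqrt_pos.2 (div_pos (mul_pos two_pos hz) hω)

lemma smooth_coord (i : Fin 4) : Smooth fun z => z i :=
  (contDiff_apply ℝ ℝ i).contDiffOn

lemma smooth_semiMinor {ω : ℝ} (hω : 0 < ω) : Smooth (semiMinor ω) :=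
  ((contDiffOn_const.mul (smooth_coord 2)).div_const ω).sqrt fun _ hz =>
    (div_pos (mul_pos two_pos hz) hω).ne'

lemma smooth_sigma {ω : ℝ} (hω : 0 < ω) : Smooth (sigma ω) :=
  ((smooth_coord 3).div_const ω).div (smooth_semiMinor hω) fun _ hz => (semiMinor_pos hω hz).ne'

lemma smooth_chi {ω : ℝ} (hω : 0 < ω) : Smooth (chi ω) :=
  (smooth_coord 1).div (contDiffOn_const.mul (smooth_semiMinor hω)) fun _ hz =>
    (mul_pos two_pos (semiMinor_pos hω hz)).ne'

lemma hamTerm_four (μ ω : ℝ) (z : Phase) : hamTerm μ ω 4 z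
    = -(36 * ω ^ 2 * semiMinor ω z ^ 2 * sigma ω z ^ 2)
      + -(24 * (μ / semiMinor ω z)) * angleFour (z 0) := by
  simp only [hamTerm, S_zero, angleFour]
  norm_num [Nat.factorial]
  ring

lemma hamTerm_five (μ ω : ℝ) (z : Phase) : hamTerm μ ω 5 z
    = 480 * (μ / semiMinor ω z) * chi ω z * angleFive (z 0) := by
  simp only [hamTerm, Nat.reduceSub, S_one, angleFive]
  norm_num [Nat.factorial]
  ring

lemma hamTerm_six (μ ω : ℝ) (z : Phase) : hamTerm μ ω 6 z
    = -(720 * (μ / semiMinor ω z) * sigma ω z) * angleSixσ (z 0)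
      + -(720 * (μ / semiMinor ω z) * chi ω z ^ 2) * angleSixχ (z 0) := by
  simp only [hamTerm, Nat.reduceSub, S_two, angleSixσ, angleSixχ]
  norm_num [Nat.factorial]
  ring

lemma poisson_hamTerm_zero (μ ω : ℝ) (V : Phase → ℝ) (z : Phase) :
    poisson (hamTerm μ ω 0) V z = -(ω * partialD 0 V z) := by
  simp [hamTerm_zero, poisson, partialD_const_mul, partialD_coord]

lemma deprit_hamTerm_eq {μ ω : ℝ} {W : ℕ → Phase → ℝ}
    (hW : ∀ m < 4, ∀ z ∈ domain, W m z = 0) (m : ℕ) (h0 : 0 < m) (h6 : m ≤ 6) {z : Phase}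
    (hz : z ∈ domain) :
    deprit (hamTerm μ ω) W 0 m z = hamTerm μ ω m z - ω * partialD 0 (W m) z := by
  obtain ⟨q, rfl⟩ := Nat.exists_eq_succ_of_ne_zero h0.ne'
  rw [Nat.succ_eq_add_one, deprit_succ_eq (fun n hn h z _ => hamTerm_low μ ω n hn h z) hW q 0
    (by omega) z hz, zero_add, poisson_hamTerm_zero]
  ring

/-- A generator of period `2π` in `φ` leaves the angular mean of each term unchanged, so the terms
of the normalized Hamiltonian are the means of the original ones. -/
lemma deprit_eq_angleMean {μ ω : ℝ} {W : ℕ → Phase → ℝ} (hW : IsNormalizing μ ω W) (m : ℕ)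
    (h0 : 0 < m) (h6 : m ≤ 6) {z : Phase} (hz : z ∈ domain)
    (hc : Continuous fun φ => hamTerm μ ω m (Function.update z 0 φ)) :
    deprit (hamTerm μ ω) W 0 m z
      = angleMean (fun φ => hamTerm μ ω m (Function.update z 0 φ)) := by
  set c := deprit (hamTerm μ ω) W 0 m z with hcdef
  have hd : ∀ φ, HasDerivAt (fun φ => ω * W m (Function.update z 0 φ))
      (hamTerm μ ω m (Function.update z 0 φ) - c) φ := by
    intro φ
    have hu := update_mem_domain hz φ
    have h := hasDerivAt_partialD ((show Smooth (W m) from hW.smooth m).differentiableAt hu) 0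
    simp only [Function.update_idem, Function.update_self] at h
    refine (h.const_mul ω).congr_deriv ?_
    rw [hcdef, ← hW.removes_angle m h6 z hz φ, deprit_hamTerm_eq hW.low_order m h0 h6 hu]
    ring
  have h := intervalIntegral.integral_eq_sub_of_hasDerivAt (a := 0) (b := 2 * π)
    (fun φ _ => hd φ) ((hc.sub continuous_const).intervalIntegrable _ _)
  -- By periodicity the generator has the same value at `φ = 0` and `φ = 2π`.
  have hp := hW.periodic m _ (update_mem_domain hz 0)
  simp only [Function.update_idem, Function.update_self, zero_add] at hp
  rw [hp, sub_self, intervalIntegral.integral_sub (hc.intervalIntegrable _ _) (by simp)] at h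
  simp only [intervalIntegral.integral_const, smul_eq_mul, sub_zero] at h
  rw [angleMean, eq_div_iff Real.two_pi_pos.ne']
  linarith

lemma deprit_four {μ ω : ℝ} {W : ℕ → Phase → ℝ} (hW : IsNormalizing μ ω W) {z : Phase}
    (hz : z ∈ domain) : deprit (hamTerm μ ω) W 0 4 z
      = -(36 * ω ^ 2 * semiMinor ω z ^ 2 * sigma ω z ^ 2)
        + -(24 * (μ / semiMinor ω z)) * (ellipticK (3 / 4) / π) := by
  have hc := contDiff_angleFour.continuous
  have h : (fun φ => hamTerm μ ω 4 (Function.update z 0 φ)) = fun φ =>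
      -(36 * ω ^ 2 * semiMinor ω z ^ 2 * sigma ω z ^ 2)
        + -(24 * (μ / semiMinor ω z)) * angleFour φ + 0 * angleFour φ := by
    funext φ
    simp [hamTerm_four, semiMinor_update, sigma_update]
  rw [deprit_eq_angleMean hW 4 (by norm_num) (by norm_num) hz (by rw [h]; fun_prop), h,
    angleMean_comb hc hc, angleMean_angleFour]
  ring

lemma deprit_five {μ ω : ℝ} {W : ℕ → Phase → ℝ} (hW : IsNormalizing μ ω W) {z : Phase}
    (hz : z ∈ domain) : deprit (hamTerm μ ω) W 0 5 z = 0 := by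
  have hc := contDiff_angleFive.continuous
  have h : (fun φ => hamTerm μ ω 5 (Function.update z 0 φ)) = fun φ =>
      0 + 480 * (μ / semiMinor ω z) * chi ω z * angleFive φ + 0 * angleFive φ := by
    funext φ
    simp [hamTerm_five, semiMinor_update, chi_update]
  rw [deprit_eq_angleMean hW 5 (by norm_num) (by norm_num) hz (by rw [h]; fun_prop), h,
    angleMean_comb hc hc, angleMean_angleFive]
  ring

lemma deprit_six {μ ω : ℝ} {W : ℕ → Phase → ℝ} (hW : IsNormalizing μ ω W) {z : Phase}
    (hz : z ∈ domain) : deprit (hamTerm μ ω) W 0 6 z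
      = -(720 * (μ / semiMinor ω z) * chi ω z ^ 2)
        * (2 * (ellipticK (3 / 4) - ellipticE (3 / 4)) / (3 * π)) := by
  have hc := contDiff_angleSixσ.continuous
  have hc' := contDiff_angleSixχ.continuous
  have h : (fun φ => hamTerm μ ω 6 (Function.update z 0 φ)) = fun φ =>
      0 + -(720 * (μ / semiMinor ω z) * sigma ω z) * angleSixσ φ
        + -(720 * (μ / semiMinor ω z) * chi ω z ^ 2) * angleSixχ φ := by
    funext φ
    simp [hamTerm_six, semiMinor_update, sigma_update, chi_update]
  rw [deprit_eq_angleMean hW 6 (by norm_num) (by norm_num) hz (by rw [h]; fun_prop), h,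
    angleMean_comb hc hc', angleMean_angleSixσ, angleMean_angleSixχ]
  ring

lemma semiMinor_sq {ω : ℝ} (hω : 0 < ω) {z : Phase} (hz : z ∈ domain) :
    z 2 = ω * semiMinor ω z ^ 2 / 2 := by
  rw [semiMinor, Real.sq_sqrt (div_pos (mul_pos two_pos hz) hω).le]
  field_simp

lemma newHam_eq {μ ω : ℝ} (hω : 0 < ω) {W : ℕ → Phase → ℝ} (hW : IsNormalizing μ ω W)
    {z : Phase} (hz : z ∈ domain) (ε : ℝ) : newHam (hamTerm μ ω) W 6 ε z =
      ω * z 2 * (1 - ε ^ 4 * (3 * sigma ω z ^ 2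
          + 2 * (ellipticK (3 / 4) / π) * (μ / (ω ^ 2 * semiMinor ω z ^ 3)))
        - ε ^ 6 * ((ellipticK (3 / 4) - ellipticE (3 / 4)) / (3 / 4 * π)
          * (μ / (ω ^ 2 * semiMinor ω z ^ 3)) * chi ω z ^ 2)) := by
  have hlow : ∀ m, 0 < m → m < 4 → deprit (hamTerm μ ω) W 0 m z = 0 := fun m h0 h4 => by
    rw [deprit_hamTerm_eq hW.low_order m h0 (by omega) hz, hamTerm_low μ ω m h0 h4,
      partialD_eq_zero, mul_zero, sub_zero]
    filter_upwards [domain_mem_nhds hz] with y hy using hW.low_order m h4 y hy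
  simp only [newHam, Finset.sum_range_succ, Finset.sum_range_zero,
    hlow 1 (by norm_num) (by norm_num),
    hlow 2 (by norm_num) (by norm_num), hlow 3 (by norm_num) (by norm_num), deprit_four hW hz,
    deprit_five hW hz, deprit_six hW hz]
  simp only [deprit, hamTerm_zero]
  rw [semiMinor_sq hω hz]
  have hB := (semiMinor_pos hω hz).ne'
  have hπ := Real.pi_pos.ne'
  norm_num [Nat.factorial]
  field_simp
  ring

/-- The generator whose derivative along `φ` is the oscillating part of the perturbation,
normalized to vanish at `φ = 0`. -/
noncomputable def normalizingGen (μ ω : ℝ) (m : ℕ) (z : Phase) : ℝ :=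
  if m = 4 then -(24 * (μ / semiMinor ω z)) / ω * oscPrimitive angleFour (z 0)
  else if m = 5 then
    480 * (μ / semiMinor ω z) * chi ω z / ω * oscPrimitive angleFive (z 0)
  else if m = 6 then
    -(720 * (μ / semiMinor ω z) * sigma ω z) / ω * oscPrimitive angleSixσ (z 0)
      + -(720 * (μ / semiMinor ω z) * chi ω z ^ 2) / ω * oscPrimitive angleSixχ (z 0)
  else 0

lemma smooth_comp_angle {g : ℝ → ℝ} (hg : ContDiff ℝ ((⊤ : ℕ∞) : WithTop ℕ∞) g) :
    Smooth fun z => g (z 0) :=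
  hg.comp_contDiffOn (smooth_coord 0)

lemma smooth_normalizingGen (μ : ℝ) {ω : ℝ} (hω : 0 < ω) (m : ℕ) :
    Smooth (normalizingGen μ ω m) := by
  have hB : Smooth fun z => μ / semiMinor ω z :=
    contDiffOn_const.div (smooth_semiMinor hω) fun _ hz => (semiMinor_pos hω hz).ne'
  have hσ := smooth_sigma hω
  have hχ := smooth_chi hω
  unfold normalizingGen
  split_ifs
  · exact ((contDiffOn_const.mul hB).neg.div_const ω).mul
      (smooth_comp_angle (contDiff_oscPrimitive contDiff_angleFour))
  · exact (((contDiffOn_const.mul hB).mul hχ).div_const ω).mul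
      (smooth_comp_angle (contDiff_oscPrimitive contDiff_angleFive))
  · exact ((((contDiffOn_const.mul hB).mul hσ).neg.div_const ω).mul
      (smooth_comp_angle (contDiff_oscPrimitive contDiff_angleSixσ))).add
      ((((contDiffOn_const.mul hB).mul (hχ.pow 2)).neg.div_const ω).mul
      (smooth_comp_angle (contDiff_oscPrimitive contDiff_angleSixχ)))
  · exact contDiffOn_const

/-- The generator solves the homological equation: `K_{m,0} - ω ∂W_m/∂φ` is independent of `φ`. -/
lemma homological_normalizingGen (μ : ℝ) {ω : ℝ} (hω : 0 < ω) (m : ℕ) (h4 : 4 ≤ m) (h6 : m ≤ 6)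
    (z : Phase) (φ : ℝ) :
    hamTerm μ ω m (Function.update z 0 φ)
        - ω * partialD 0 (normalizingGen μ ω m) (Function.update z 0 φ)
      = hamTerm μ ω m z - ω * partialD 0 (normalizingGen μ ω m) z := by
  have hω' := hω.ne'
  have d4 := hasDerivAt_oscPrimitive contDiff_angleFour.continuous
  have d5 := hasDerivAt_oscPrimitive contDiff_angleFive.continuous
  have d6 := hasDerivAt_oscPrimitive contDiff_angleSixσ.continuous
  have d7 := hasDerivAt_oscPrimitive contDiff_angleSixχ.continuous
  have hm : m = 4 ∨ m = 5 ∨ m = 6 := by omega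
  rcases hm with rfl | rfl | rfl
  · have h : ∀ y : Phase, partialD 0 (normalizingGen μ ω 4) y
        = -(24 * (μ / semiMinor ω y)) / ω * (angleFour (y 0) - angleMean angleFour) := fun y => by
      simp only [partialD, normalizingGen, semiMinor_update, Function.update_self, if_true]
      exact ((d4 (y 0)).const_mul _).deriv
    simp only [h, hamTerm_four, semiMinor_update, sigma_update]
    field_simp
    ring
  · have h : ∀ y : Phase, partialD 0 (normalizingGen μ ω 5) y
        = 480 * (μ / semiMinor ω y) * chi ω y / ω
          * (angleFive (y 0) - angleMean angleFive) := fun y => by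
      simp only [partialD, normalizingGen, semiMinor_update, chi_update, Function.update_self,
        Nat.reduceEqDiff, if_true, if_false]
      exact ((d5 (y 0)).const_mul _).deriv
    simp only [h, hamTerm_five, semiMinor_update, chi_update]
    field_simp
    ring
  · have h : ∀ y : Phase, partialD 0 (normalizingGen μ ω 6) y
        = -(720 * (μ / semiMinor ω y) * sigma ω y) / ω * (angleSixσ (y 0) - angleMean angleSixσ)
          + -(720 * (μ / semiMinor ω y) * chi ω y ^ 2) / ω
            * (angleSixχ (y 0) - angleMean angleSixχ) := fun y => by
      simp only [partialD, normalizingGen, semiMinor_update, sigma_update, chi_update,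
        Function.update_self, Nat.reduceEqDiff, if_true, if_false]
      exact (((d6 (y 0)).const_mul _).add ((d7 (y 0)).const_mul _)).deriv
    simp only [h, hamTerm_six, semiMinor_update, sigma_update, chi_update]
    field_simp
    ring

lemma isNormalizing_normalizingGen (μ : ℝ) {ω : ℝ} (hω : 0 < ω) :
    IsNormalizing μ ω (normalizingGen μ ω) := by
  have hlow : ∀ m < 4, ∀ z ∈ domain, normalizingGen μ ω m z = 0 := fun m hm z _ => by
    simp [normalizingGen, show m ≠ 4 by omega, show m ≠ 5 by omega, show m ≠ 6 by omega]
  refine ⟨smooth_normalizingGen μ hω, fun m z _ => ?_, hlow, fun m hm z hz φ => ?_⟩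
  · simp only [normalizingGen, semiMinor_update, sigma_update, chi_update, Function.update_self,
      oscPrimitive_periodic contDiff_angleFour.continuous periodic_angleFour,
      oscPrimitive_periodic contDiff_angleFive.continuous periodic_angleFive,
      oscPrimitive_periodic contDiff_angleSixσ.continuous periodic_angleSixσ,
      oscPrimitive_periodic contDiff_angleSixχ.continuous periodic_angleSixχ]
  · have hu := update_mem_domain hz φ
    rcases Nat.eq_zero_or_pos m with rfl | h0
    · simp [deprit, hamTerm_zero]
    rw [deprit_hamTerm_eq hlow m h0 hm hu, deprit_hamTerm_eq hlow m h0 hm hz]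
    rcases lt_or_ge m 4 with h4 | h4
    · have hz0 : ∀ y ∈ domain, partialD 0 (normalizingGen μ ω m) y = 0 := fun y hy => by
        apply partialD_eq_zero
        filter_upwards [domain_mem_nhds hy] with x hx using hlow m h4 x hx
      rw [hamTerm_low μ ω m h0 h4, hamTerm_low μ ω m h0 h4, hz0 _ hu, hz0 z hz]
    · exact homological_normalizingGen μ hω m h4 hm z φ

/-! ### The transformed Hamiltonian -/

lemma hillHam_eq_orderedHam {μ ω : ℝ} (hω : 0 < ω) {z : Phase} (hz : z ∈ domain) :
    hillHam μ ω (cartX ω z) (cartY ω z) (cartPX ω z) (cartPY ω z) = orderedHam μ ω 1 z := by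
  have hB := semiMinor_pos hω hz
  have hsq : √(2 * ω * z 2) = ω * semiMinor ω z := by
    rw [semiMinor_sq hω hz, show 2 * ω * (ω * semiMinor ω z ^ 2 / 2) = (ω * semiMinor ω z) ^ 2 by
      ring, Real.sqrt_sq (mul_pos hω hB).le]
  have hQ : z 3 = ω * semiMinor ω z * sigma ω z := by
    have := hω.ne'
    have := hB.ne'
    unfold sigma; field_simp
  have hq : z 1 = 2 * semiMinor ω z * chi ω z := by
    have h2 : semiMajor ω z = 2 * semiMinor ω z := rfl
    have := hB.ne'
    rw [chi, h2]; field_simp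
  have hcs := Real.sin_sq_add_cos_sq (z 0)
  have hx : cartX ω z = semiMinor ω z * (2 * sigma ω z + Real.sin (z 0)) := by
    rw [cartX, hsq, hQ]; field_simp
  have hy : cartY ω z = semiMinor ω z * (2 * chi ω z + 2 * Real.cos (z 0)) := by
    rw [cartY, hsq, hq]; field_simp
  have hr : √(cartX ω z ^ 2 + cartY ω z ^ 2)
      = semiMinor ω z * rho (z 0) (sigma ω z) (chi ω z) := by
    have hsum : cartX ω z ^ 2 + cartY ω z ^ 2 = semiMinor ω z ^ 2
        * (1 + 3 * Real.cos (z 0) ^ 2 + 4 * sigma ω z * Real.sin (z 0)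
          + 8 * chi ω z * Real.cos (z 0) + 4 * sigma ω z ^ 2 + 4 * chi ω z ^ 2) := by
      rw [hx, hy]
      linear_combination semiMinor ω z ^ 2 * hcs
    rw [hsum, Real.sqrt_mul (sq_nonneg _), Real.sqrt_sq hB.le, rho]
  rw [hillHam, hr, hx, hy, cartPX, cartPY, hsq, orderedHam, hQ, hq, semiMinor_sq hω hz]
  simp only [one_pow, one_mul]
  rw [mul_one_div, div_div]
  linear_combination (ω ^ 2 * semiMinor ω z ^ 2 / 2) * hcs

/-- The perturbation: `orderedHam = ωΦ - ε⁴ perturbation`. -/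
noncomputable def perturbation (μ ω : ℝ) (p : ℝ × Phase) : ℝ :=
  3 / 2 * ω ^ 2 * semiMinor ω p.2 ^ 2 * sigma ω p.2 ^ 2
    + μ / semiMinor ω p.2 * (1 / rho (p.2 0) (p.1 ^ 2 * sigma ω p.2) (p.1 * chi ω p.2))

lemma contDiffAt_perturbation {μ ω : ℝ} (hω : 0 < ω) {z : Phase} (hz : z ∈ domain) :
    ContDiffAt ℝ 1 (perturbation μ ω) (0, z) := by
  have hlift : ∀ {f : Phase → ℝ}, Smooth f →
      ContDiffAt ℝ 1 (fun p : ℝ × Phase => f p.2) (0, z) := fun hf =>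
    ContDiffAt.comp (f := Prod.snd) (0, z)
      ((hf.contDiffAt hz).of_le (by exact_mod_cast le_top)) contDiffAt_snd
  have hB := hlift (smooth_semiMinor hω)
  have hσ := hlift (smooth_sigma hω)
  have hχ := hlift (smooth_chi hω)
  have hφ := hlift (smooth_coord 0)
  have hB0 := (semiMinor_pos hω hz).ne'
  have hr : ContDiffAt ℝ 1 (fun p : ℝ × Phase =>
      radicand (p.2 0) (sigma ω p.2) (chi ω p.2) p.1) (0, z) := by
    unfold radicand
    fun_prop
  have hr0 : radicand (z 0) (sigma ω z) (chi ω z) 0 ≠ 0 := by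
    rw [radicand_zero]; exact (pow_pos (Delta_pos _) 2).ne'
  have hs0 : √(radicand (z 0) (sigma ω z) (chi ω z) 0) ≠ 0 := by
    rw [radicand_zero, Real.sqrt_sq (Delta_pos _).le]; exact (Delta_pos _).ne'
  unfold perturbation
  simp only [rho_eq_sqrt_radicand]
  exact ((contDiffAt_const.mul (hB.pow 2)).mul (hσ.pow 2)).add
    ((contDiffAt_const.div hB hB0).mul (contDiffAt_const.div (hr.sqrt hr0) hs0))

lemma perturbation_taylor_isBigO {μ ω : ℝ} (hω : 0 < ω) {z₀ : Phase} (hz₀ : z₀ ∈ domain) :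
    (fun p : ℝ × Phase => perturbation μ ω p + (hamTerm μ ω 4 p.2 / 24
      + p.1 * (hamTerm μ ω 5 p.2 / 120) + p.1 ^ 2 * (hamTerm μ ω 6 p.2 / 720)))
      =O[𝓝 ((0 : ℝ), z₀)] fun p => p.1 ^ 3 := by
  have hlift : ∀ {f : Phase → ℝ}, Smooth f →
      ContinuousAt (fun p : ℝ × Phase => f p.2) (0, z₀) := fun hf =>
    ContinuousAt.comp (f := Prod.snd) (hf.continuousAt hz₀) continuousAt_snd
  have hB := hlift (smooth_semiMinor hω)
  have ht : Tendsto (fun p : ℝ × Phase => (p.1, p.2 0, sigma ω p.2, chi ω p.2))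
      (𝓝 ((0 : ℝ), z₀)) (𝓝 (0, z₀ 0, sigma ω z₀, chi ω z₀)) :=
    (continuousAt_fst (p := ((0 : ℝ), z₀))).prodMk ((hlift (smooth_coord 0)).prodMk
      ((hlift (smooth_sigma hω)).prodMk (hlift (smooth_chi hω))))
  have h1 := (inv_rho_taylor_isBigO (z₀ 0) (sigma ω z₀) (chi ω z₀)).comp_tendsto ht
  have h2 : (fun p : ℝ × Phase => μ / semiMinor ω p.2) =O[𝓝 ((0 : ℝ), z₀)] fun _ => (1 : ℝ) :=
    (continuousAt_const.div hB (semiMinor_pos hω hz₀).ne').isBigO_one ℝ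
  refine (h2.mul h1).congr (fun p => ?_) (fun p => by simp)
  simp only [Function.comp, perturbation, S_one, S_two, hamTerm_four, hamTerm_five, hamTerm_six,
    angleFour, angleFive, angleSixσ, angleSixχ]
  ring

/-- The displacement has order `ε⁴`, so only its first-order effect on `ωΦ` is visible below order
eight, and it cancels the oscillating part of the perturbation. The perturbation itself is
Lipschitz and needs to be expanded only to order two. -/
lemma orderedHam_lieTransform_isBigO {μ ω : ℝ} (hω : 0 < ω) {W : ℕ → Phase → ℝ}
    (hW : ∀ m, Smooth (W m)) (hlow : ∀ m < 4, ∀ z ∈ domain, W m z = 0)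
    {z₀ : Phase} (hz₀ : z₀ ∈ domain) :
    (fun p : ℝ × Phase => orderedHam μ ω p.1 (lieTransform W 6 p.1 p.2)
      - newHam (hamTerm μ ω) W 6 p.1 p.2) =O[𝓝 ((0 : ℝ), z₀)] fun p => p.1 ^ 7 := by
  have hdom : ∀ᶠ p : ℝ × Phase in 𝓝 ((0 : ℝ), z₀), p.2 ∈ domain :=
    continuousAt_snd.eventually (domain_mem_nhds (z := ((0, z₀) : ℝ × Phase).2) hz₀)
  let v : ℝ × Phase → Phase := fun p => hamVec (genSum W p.1) p.2
  have hT : (fun p : ℝ × Phase => lieTransform W 6 p.1 p.2)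
      =ᶠ[𝓝 ((0 : ℝ), z₀)] fun p => p.2 + p.1 ^ 4 • v p := by
    filter_upwards [hdom] with p hp
    funext i
    simp [lieTransform_eq hW hlow p.1 hp, v]
  have hv : ContinuousAt v (0, z₀) := by
    refine continuousAt_pi.2 fun i => ?_
    refine (continuousAt_genSum (fun m => (hW m).hamVec i) hz₀ 0).congr ?_
    filter_upwards [hdom] with p hp using (hamVec_genSum hW p.1 hp i).symm
  have hTc : Tendsto (fun p : ℝ × Phase => (p.1, lieTransform W 6 p.1 p.2)) (𝓝 ((0 : ℝ), z₀))
      (𝓝 ((0 : ℝ), z₀)) := by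
    have h : ContinuousAt (fun p : ℝ × Phase => (p.1, p.2 + p.1 ^ 4 • v p)) ((0 : ℝ), z₀) :=
      continuousAt_fst.prodMk (continuousAt_snd.add ((continuousAt_fst.pow 4).smul hv))
    have h' : Tendsto (fun p : ℝ × Phase => (p.1, p.2 + p.1 ^ 4 • v p)) (𝓝 ((0 : ℝ), z₀))
        (𝓝 ((0 : ℝ), z₀)) := by simpa [ContinuousAt] using h
    exact h'.congr' (by filter_upwards [hT] with p hp; rw [hp])
  obtain ⟨C, t, ht, hL⟩ := (contDiffAt_perturbation (μ := μ) hω hz₀).exists_lipschitzOnWith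
  have hlip : (fun p : ℝ × Phase => perturbation μ ω (p.1, lieTransform W 6 p.1 p.2)
      - perturbation μ ω p) =O[𝓝 ((0 : ℝ), z₀)] fun p => p.1 ^ 3 := by
    have h1 : (fun p : ℝ × Phase => perturbation μ ω (p.1, lieTransform W 6 p.1 p.2)
        - perturbation μ ω p) =O[𝓝 ((0 : ℝ), z₀)] fun p => p.1 ^ 4 • v p := by
      refine IsBigO.of_bound C ?_
      filter_upwards [hTc.eventually ht, ht, hT] with p h1 h2 h3
      refine (hL.norm_sub_le h1 h2).trans (le_of_eq ?_)
      rw [h3, show (p.1, p.2 + p.1 ^ 4 • v p) - p = (0, p.1 ^ 4 • v p) by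
        ext <;> simp, Prod.norm_mk, norm_zero, max_eq_right (norm_nonneg _)]
    have h2 : (fun p : ℝ × Phase => p.1 ^ 4 • v p) =O[𝓝 ((0 : ℝ), z₀)] fun p => p.1 ^ 3 := by
      have h3 : (fun p : ℝ × Phase => p.1 • v p) =O[𝓝 ((0 : ℝ), z₀)] fun _ => (1 : ℝ) :=
        (continuousAt_fst.smul hv).isBigO_one ℝ
      refine ((isBigO_refl (fun p : ℝ × Phase => p.1 ^ 3) _).smul h3).congr
        (fun p => ?_) (fun p => by simp)
      rw [smul_smul]; ring_nf
    exact h1.trans h2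
  have hmain := (isBigO_refl (fun p : ℝ × Phase => -p.1 ^ 4) (𝓝 ((0 : ℝ), z₀))).mul
    (hlip.add (perturbation_taylor_isBigO (μ := μ) hω hz₀))
  refine (hmain.congr' ?_ (Eventually.of_forall fun p => rfl)).trans ?_
  · filter_upwards [hdom] with p hp
    rw [newHam, sum_deprit_eq (fun n hn h z _ => hamTerm_low μ ω n hn h z) hlow p.1 hp]
    simp only [poisson_hamTerm_zero]
    have h2 : lieTransform W 6 p.1 p.2 2 = p.2 2 - p.1 ^ 4 * (partialD 0 (W 4) p.2 / 24
        + p.1 * (partialD 0 (W 5) p.2 / 120) + p.1 ^ 2 * (partialD 0 (W 6) p.2 / 720)) := by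
      rw [lieTransform_eq hW hlow p.1 hp, hamVec_genSum hW p.1 hp]
      simp [genSum, hamVec]
      ring
    have h3 : orderedHam μ ω p.1 (lieTransform W 6 p.1 p.2) = ω * lieTransform W 6 p.1 p.2 2
      - p.1 ^ 4 * perturbation μ ω (p.1, lieTransform W 6 p.1 p.2) := rfl
    rw [h3, h2, hamTerm_zero]
    ring
  · refine IsBigO.of_bound 1 (Eventually.of_forall fun p => ?_)
    rw [one_mul, show -p.1 ^ 4 * p.1 ^ 3 = -p.1 ^ 7 by ring, norm_neg]

/-! ### The reduced flow -/

lemma Kt_sub_Et_pos : 0 < Kt - Et := by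
  rw [Kt, Et, ← sub_div]
  exact div_pos (sub_pos.2 ellipticE_lt_ellipticK) Real.pi_pos

lemma libFreq_arg_pos {μ ω : ℝ} (hμ : 0 < μ) (hω : 0 < ω) {z : Phase} (hz : z ∈ domain) :
    0 < (Kt - Et) * (μ / semiMinor ω z ^ 3) :=
  mul_pos Kt_sub_Et_pos (div_pos hμ (pow_pos (semiMinor_pos hω hz) 3))

lemma libFreq_pos {μ ω : ℝ} (hμ : 0 < μ) (hω : 0 < ω) {z : Phase} (hz : z ∈ domain) :
    0 < libFreq μ ω z :=
  Real.sqrt_pos.2 (libFreq_arg_pos hμ hω hz)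

lemma libFreq_sq {μ ω : ℝ} (hμ : 0 < μ) (hω : 0 < ω) {z : Phase} (hz : z ∈ domain) :
    libFreq μ ω z ^ 2 = (Kt - Et) * (μ / semiMinor ω z ^ 3) :=
  Real.sq_sqrt (libFreq_arg_pos hμ hω hz).le

/-- The normalized Hamiltonian in the canonical variables, with `B` as a function of `Φ`. -/
lemma normalizedHam_eq {μ ω : ℝ} (hω : 0 < ω) {z : Phase} (hz : z ∈ domain) :
    normalizedHam μ ω z = ω * z 2 - 3 / 2 * z 3 ^ 2 - Kt * μ / √(2 * z 2 / ω)
      - (Kt - Et) * μ / 6 * z 1 ^ 2 / √(2 * z 2 / ω) ^ 3 := by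
  have hB := (semiMinor_pos hω hz).ne'
  have hπ := Real.pi_pos.ne'
  change _ = ω * z 2 - 3 / 2 * z 3 ^ 2 - Kt * μ / semiMinor ω z
      - (Kt - Et) * μ / 6 * z 1 ^ 2 / semiMinor ω z ^ 3
  have hA : semiMajor ω z = 2 * semiMinor ω z := rfl
  rw [normalizedHam, sigma, chi, hA, Kt, Et, semiMinor_sq hω hz]
  field_simp
  ring

lemma normalizedHam_eventuallyEq {μ ω : ℝ} (hω : 0 < ω) {z : Phase} (hz : z ∈ domain) :
    normalizedHam μ ω =ᶠ[𝓝 z] fun y => ω * y 2 - 3 / 2 * y 3 ^ 2 - Kt * μ / √(2 * y 2 / ω)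
      - (Kt - Et) * μ / 6 * y 1 ^ 2 / √(2 * y 2 / ω) ^ 3 := by
  filter_upwards [domain_mem_nhds hz] with y hy using normalizedHam_eq hω hy

lemma partialD_zero_normalizedHam (μ ω : ℝ) (z : Phase) :
    partialD 0 (normalizedHam μ ω) z = 0 := by
  simp [partialD, normalizedHam, sigma_update, chi_update, semiMinor_update]

lemma partialD_one_normalizedHam {μ ω : ℝ} (hμ : 0 < μ) (hω : 0 < ω) {z : Phase}
    (hz : z ∈ domain) :
    partialD 1 (normalizedHam μ ω) z = -(1 / 3 * libFreq μ ω z ^ 2 * z 1) := by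
  rw [partialD_congr (normalizedHam_eventuallyEq hω hz), libFreq_sq hμ hω hz]
  simp only [partialD, Function.update_self, Function.update_of_ne, ne_eq, Fin.reduceEq,
    not_false_eq_true]
  have h := ((((hasDerivAt_pow 2 (z 1)).const_mul ((Kt - Et) * μ / 6)).div_const
    (√(2 * z 2 / ω) ^ 3)).const_sub (ω * z 2 - 3 / 2 * z 3 ^ 2 - Kt * μ / √(2 * z 2 / ω))).deriv
  refine h.trans ?_
  rw [semiMinor]
  norm_num
  ring

lemma partialD_three_normalizedHam {μ ω : ℝ} (hω : 0 < ω) {z : Phase} (hz : z ∈ domain) :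
    partialD 3 (normalizedHam μ ω) z = -3 * z 3 := by
  rw [partialD_congr (normalizedHam_eventuallyEq hω hz)]
  simp only [partialD, Function.update_self, Function.update_of_ne, ne_eq, Fin.reduceEq,
    not_false_eq_true]
  have h := (((((hasDerivAt_pow 2 (z 3)).const_mul (3 / 2)).const_sub (ω * z 2)).sub_const
    (Kt * μ / √(2 * z 2 / ω))).sub_const
    ((Kt - Et) * μ / 6 * z 1 ^ 2 / √(2 * z 2 / ω) ^ 3)).deriv
  refine h.trans ?_
  norm_num
  ring

lemma partialD_two_normalizedHam {μ ω : ℝ} (hμ : 0 < μ) (hω : 0 < ω) {z : Phase}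
    (hz : z ∈ domain) :
    partialD 2 (normalizedHam μ ω) z = ω + libFreq μ ω z ^ 2 / ω
      * (Kt / (Kt - Et) + z 1 ^ 2 / (2 * semiMinor ω z ^ 2)) := by
  rw [partialD_congr (normalizedHam_eventuallyEq hω hz), libFreq_sq hμ hω hz]
  simp only [partialD, Function.update_self, Function.update_of_ne, ne_eq, Fin.reduceEq,
    not_false_eq_true]
  have hB := (semiMinor_pos hω hz).ne'
  have hω' := hω.ne'
  have hK := Kt_sub_Et_pos.ne'
  have hs : HasDerivAt (fun t : ℝ => √(2 * t / ω)) (1 / (ω * semiMinor ω z)) (z 2) := by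
    have h := (((hasDerivAt_id (z 2)).const_mul 2).div_const ω).sqrt
      (div_pos (mul_pos two_pos hz) hω).ne'
    refine h.congr_deriv ?_
    change 2 * 1 / ω / (2 * semiMinor ω z) = _
    field_simp
  have h1 := (hasDerivAt_const (z 2) (Kt * μ)).div hs hB
  have h3 := (hasDerivAt_const (z 2) ((Kt - Et) * μ / 6 * z 1 ^ 2)).div (hs.pow 3)
    (pow_ne_zero 3 hB)
  have h := (((((hasDerivAt_id (z 2)).const_mul ω).sub_const
    (3 / 2 * z 3 ^ 2)).sub h1).sub h3).deriv
  refine h.trans ?_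
  simp only [Pi.pow_apply]
  change ω * 1 - (0 * semiMinor ω z - Kt * μ * (1 / (ω * semiMinor ω z))) / semiMinor ω z ^ 2
    - (0 * semiMinor ω z ^ 3 - (Kt - Et) * μ / 6 * z 1 ^ 2
      * ((3 : ℕ) * semiMinor ω z ^ (3 - 1) * (1 / (ω * semiMinor ω z))))
      / (semiMinor ω z ^ 3) ^ 2 = _
  norm_num
  field_simp
  ring

lemma normalizedHam_eq_libFreq {μ ω : ℝ} (hμ : 0 < μ) (hω : 0 < ω) {z : Phase}
    (hz : z ∈ domain) : normalizedHam μ ω z = ω * z 2 * (1 - 3 * sigma ω z ^ 2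
        - libFreq μ ω z ^ 2 / ω ^ 2 * (2 * Kt / (Kt - Et) + 4 / 3 * chi ω z ^ 2)) := by
  have hB := (semiMinor_pos hω hz).ne'
  have hK := Kt_sub_Et_pos.ne'
  have hω' := hω.ne'
  have hEK : (ellipticK (3 / 4) - ellipticE (3 / 4)) / (3 / 4 * π) = 4 / 3 * (Kt - Et) := by
    rw [Kt, Et]
    have := Real.pi_pos.ne'
    field_simp
  rw [normalizedHam, hEK, ← Kt, libFreq_sq hμ hω hz]
  field_simp
  ring

/-- The momentum `Φ` is conserved because the Hamiltonian does not depend on `φ`, also off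
`Φ > 0`; this keeps the whole orbit in the domain. -/
lemma orbit_Phi_const {μ ω : ℝ} {γ : ℝ → Phase}
    (h : ∀ t, HasDerivAt γ (hamVec (normalizedHam μ ω) (γ t)) t) (t : ℝ) : γ t 2 = γ 0 2 := by
  have hd : ∀ t, HasDerivAt (fun s => γ s 2) 0 t := fun t => by
    have := hasDerivAt_pi.1 (h t) 2
    simpa [hamVec, partialD_zero_normalizedHam] using this
  exact is_const_of_deriv_eq_zero (fun t => (hd t).differentiableAt) (fun t => (hd t).deriv) t 0

lemma semiMinor_congr (ω : ℝ) {z w : Phase} (h : w 2 = z 2) : semiMinor ω w = semiMinor ω z := by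
  rw [semiMinor, semiMinor, h]

lemma libFreq_congr (μ ω : ℝ) {z w : Phase} (h : w 2 = z 2) : libFreq μ ω w = libFreq μ ω z := by
  rw [libFreq, libFreq, semiMinor_congr ω h]

lemma hamVec_normalizedHam {μ ω : ℝ} (hμ : 0 < μ) (hω : 0 < ω) {z w : Phase} (hz : z ∈ domain)
    (h : w 2 = z 2) : hamVec (normalizedHam μ ω) w =
      ![ω + libFreq μ ω z ^ 2 / ω * (Kt / (Kt - Et) + w 1 ^ 2 / (2 * semiMinor ω z ^ 2)),
        -3 * w 3, 0, 1 / 3 * libFreq μ ω z ^ 2 * w 1] := by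
  have hw : w ∈ domain := by simpa [domain, h] using hz
  rw [hamVec, partialD_zero_normalizedHam, partialD_one_normalizedHam hμ hω hw,
    partialD_two_normalizedHam hμ hω hw, partialD_three_normalizedHam hω hw,
    semiMinor_congr ω h, libFreq_congr μ ω h, neg_neg, neg_zero]

/-- Uniqueness: the difference of two orbits in `(q, Q)` solves the oscillator equations with zero
initial value, so its energy `Ω²/3 u² + 3 v²` vanishes; then the rates of `φ` agree as well. -/
lemma orbit_unique {μ ω : ℝ} (hμ : 0 < μ) (hω : 0 < ω) {γ η : ℝ → Phase} (h0 : γ 0 = η 0)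
    (hz : γ 0 ∈ domain) (hγ : ∀ t, HasDerivAt γ (hamVec (normalizedHam μ ω) (γ t)) t)
    (hη : ∀ t, HasDerivAt η (hamVec (normalizedHam μ ω) (η t)) t) (t : ℝ) : γ t = η t := by
  set z := γ 0 with hzdef
  set Ω := libFreq μ ω z with hΩdef
  have hΩ : 0 < Ω := libFreq_pos hμ hω hz
  have hγ2 : ∀ t, γ t 2 = z 2 := orbit_Phi_const hγ
  have hη2 : ∀ t, η t 2 = z 2 := fun t => by rw [orbit_Phi_const hη t, h0]
  have hγ' : ∀ (t : ℝ) (i : Fin 4), HasDerivAt (fun s => γ s i) _ t :=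
    fun t i => hasDerivAt_pi.1 (hamVec_normalizedHam hμ hω hz (hγ2 t) ▸ hγ t) i
  have hη' : ∀ (t : ℝ) (i : Fin 4), HasDerivAt (fun s => η s i) _ t :=
    fun t i => hasDerivAt_pi.1 (hamVec_normalizedHam hμ hω hz (hη2 t) ▸ hη t) i
  have hE : ∀ t, Ω ^ 2 / 3 * (γ t 1 - η t 1) ^ 2 + 3 * (γ t 3 - η t 3) ^ 2 = 0 := by
    have hd : ∀ t, HasDerivAt (fun s => Ω ^ 2 / 3 * (γ s 1 - η s 1) ^ 2
        + 3 * (γ s 3 - η s 3) ^ 2) 0 t := fun t => by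
      have h1 := (((hγ' t 1).sub (hη' t 1)).pow 2).const_mul (Ω ^ 2 / 3)
      have h3 := (((hγ' t 3).sub (hη' t 3)).pow 2).const_mul 3
      refine (h1.add h3).congr_deriv ?_
      simp
      ring
    intro t
    rw [is_const_of_deriv_eq_zero (fun t => (hd t).differentiableAt) (fun t => (hd t).deriv) t 0]
    simp [← hzdef, h0]
  have h1 : ∀ t, γ t 1 = η t 1 := fun t => by
    have := hE t
    have h3 : Ω ^ 2 / 3 * (γ t 1 - η t 1) ^ 2 = 0 := by
      have := mul_nonneg (by positivity : 0 ≤ Ω ^ 2 / 3) (sq_nonneg (γ t 1 - η t 1))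
      nlinarith [sq_nonneg (γ t 3 - η t 3)]
    have h4 := (mul_eq_zero.1 h3).resolve_left (by positivity)
    exact sub_eq_zero.1 (pow_eq_zero_iff two_ne_zero |>.1 h4)
  have h3 : ∀ t, γ t 3 = η t 3 := fun t => by
    have := hE t
    rw [h1 t] at this
    have h4 : (γ t 3 - η t 3) ^ 2 = 0 := by linarith [this, sub_self (η t 1)]
    exact sub_eq_zero.1 (pow_eq_zero_iff two_ne_zero |>.1 h4)
  have hφ : γ t 0 = η t 0 := by
    have hd : ∀ t, HasDerivAt (fun s => γ s 0 - η s 0) 0 t := fun t => by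
      refine ((hγ' t 0).sub (hη' t 0)).congr_deriv ?_
      simp [h1 t]
    have := is_const_of_deriv_eq_zero (fun t => (hd t).differentiableAt)
      (fun t => (hd t).deriv) t 0
    simp only [← hzdef, h0, sub_self] at this
    exact sub_eq_zero.1 this
  funext i
  fin_cases i
  · exact hφ
  · exact h1 t
  · exact (hγ2 t).trans (hη2 t).symm
  · exact h3 t

lemma solution_zero (μ ω : ℝ) (z : Phase) : solution μ ω z 0 = z := by
  funext i
  fin_cases i <;> simp [solution]

lemma hasDerivAt_solution {μ ω : ℝ} (hμ : 0 < μ) (hω : 0 < ω) {z : Phase} (hz : z ∈ domain)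
    (t : ℝ) : HasDerivAt (solution μ ω z) (hamVec (normalizedHam μ ω) (solution μ ω z t)) t := by
  have h2 : solution μ ω z t 2 = z 2 := by simp [solution]
  rw [hamVec_normalizedHam hμ hω hz h2, hasDerivAt_pi]
  have hΩ := (libFreq_pos hμ hω hz).ne'
  have hB := (semiMinor_pos hω hz).ne'
  have hω' := hω.ne'
  have hlin : ∀ a : ℝ, HasDerivAt (fun s : ℝ => a * s) a t := fun a => by
    simpa using (hasDerivAt_id t).const_mul a
  have hc := (hlin (libFreq μ ω z)).cos
  have hs := (hlin (libFreq μ ω z)).sin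
  have hc2 := (hlin (2 * libFreq μ ω z)).cos
  have hs2 := (hlin (2 * libFreq μ ω z)).sin
  -- With `Q_* = Ω p_* / 3` the oscillator equations become polynomial identities in `Ω`, `q_*`, `p_*`.
  have hp : z 3 = libFreq μ ω z * pStar μ ω z / 3 := by rw [pStar]; field_simp
  have e1 : solution μ ω z t 1 = z 1 * Real.cos (libFreq μ ω z * t)
      - pStar μ ω z * Real.sin (libFreq μ ω z * t) := by simp [solution]
  have e3 : solution μ ω z t 3 = z 3 * Real.cos (libFreq μ ω z * t)
      + z 1 * libFreq μ ω z / 3 * Real.sin (libFreq μ ω z * t) := by simp [solution]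
  intro i
  fin_cases i
  · have h := (((hlin (ω * (1 + delta μ ω z))).const_add (z 0)).add
      (hs2.const_mul (libFreq μ ω z / ω
        * ((z 1 ^ 2 - pStar μ ω z ^ 2) / (8 * semiMinor ω z ^ 2))))).add
      ((hc2.sub_const 1).const_mul (libFreq μ ω z / ω
        * (z 1 * pStar μ ω z / (4 * semiMinor ω z ^ 2))))
    refine HasDerivAt.congr_deriv h ?_
    have hK := Kt_sub_Et_pos.ne'
    have hcs := Real.sin_sq_add_cos_sq (libFreq μ ω z * t)
    simp only [Fin.zero_eta, Matrix.cons_val_zero, e1, delta]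
    rw [mul_assoc 2 (libFreq μ ω z) t, Real.cos_two_mul, Real.sin_two_mul]
    generalize Real.cos (libFreq μ ω z * t) = c at *
    generalize Real.sin (libFreq μ ω z * t) = s at *
    have hs : s ^ 2 = 1 - c ^ 2 := by linarith
    field_simp
    ring_nf
    rw [hs]
    ring
  · have h := (hc.const_mul (z 1)).sub (hs.const_mul (pStar μ ω z))
    refine HasDerivAt.congr_deriv h ?_
    simp only [Fin.mk_one, Matrix.cons_val_one, Matrix.cons_val_zero, e3]
    rw [hp]
    ring
  · exact hasDerivAt_const t (z 2)
  · have h := (hc.const_mul (z 3)).add (hs.const_mul (z 1 * libFreq μ ω z / 3))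
    refine HasDerivAt.congr_deriv h ?_
    simp only [Fin.reduceFinMk, Matrix.cons_val, e1]
    rw [hp]
    ring

end HillDRO

theorem mainTheorem2 (μ ω : ℝ) (hμ : 0 < μ) (hω : 0 < ω) :
    -- the ordered Hamiltonian is the Hill Hamiltonian at ε = 1, with expansion ∑ εᵐ/m! K_{m,0}
    (∀ z ∈ domain,
      hillHam μ ω (cartX ω z) (cartY ω z) (cartPX ω z) (cartPY ω z) = orderedHam μ ω 1 z) ∧
    (∀ z ∈ domain, ∀ᶠ ε in 𝓝 (0 : ℝ),
      HasSum (fun m : ℕ => ε ^ m / (m.factorial : ℝ) * hamTerm μ ω m z) (orderedHam μ ω ε z)) ∧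
    (∀ φ σ χ : ℝ, S 0 φ σ χ = 1 ∧ S 1 φ σ χ = -4 * χ * Real.cos φ ∧
      S 2 φ σ χ = -(7 / 2) * σ * Real.sin φ - 3 / 2 * σ * Real.sin (3 * φ)
        + 7 * χ ^ 2 + 9 * χ ^ 2 * Real.cos (2 * φ)) ∧
    -- the Lie-transform normalization through order six
    (∃ W : ℕ → Phase → ℝ, IsNormalizing μ ω W) ∧
    (∀ W : ℕ → Phase → ℝ, IsNormalizing μ ω W →
      (∀ z ∈ domain, newHam (hamTerm μ ω) W 6 1 z = normalizedHam μ ω z) ∧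
      (∀ z ∈ domain, ∀ ε : ℝ, newHam (hamTerm μ ω) W 6 ε z =
        ω * z 2 * (1 - ε ^ 4 * (3 * sigma ω z ^ 2
            + 2 * (ellipticK (3 / 4) / π) * (μ / (ω ^ 2 * semiMinor ω z ^ 3)))
          - ε ^ 6 * ((ellipticK (3 / 4) - ellipticE (3 / 4)) / (3 / 4 * π)
            * (μ / (ω ^ 2 * semiMinor ω z ^ 3)) * chi ω z ^ 2))) ∧
      (∀ z₀ ∈ domain, ∀ i j : Fin 4,
        (fun p : ℝ × Phase =>
          poisson (fun z => lieTransform W 6 p.1 z i) (fun z => lieTransform W 6 p.1 z j) p.2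
            - poisson (fun z => z i) (fun z => z j) p.2)
          =O[𝓝 ((0 : ℝ), z₀)] fun p => p.1 ^ 7) ∧
      (∀ z₀ ∈ domain,
        (fun p : ℝ × Phase =>
          orderedHam μ ω p.1 (lieTransform W 6 p.1 p.2) - newHam (hamTerm μ ω) W 6 p.1 p.2)
          =O[𝓝 ((0 : ℝ), z₀)] fun p => p.1 ^ 7)) ∧
    -- the normalized Hamiltonian in terms of the libration frequency, and its reduced flow
    (∀ z ∈ domain, 0 < libFreq μ ω z ∧
      normalizedHam μ ω z = ω * z 2 * (1 - 3 * sigma ω z ^ 2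
        - libFreq μ ω z ^ 2 / ω ^ 2 * (2 * Kt / (Kt - Et) + 4 / 3 * chi ω z ^ 2)) ∧
      partialD 3 (normalizedHam μ ω) z = -3 * z 3 ∧
      -partialD 1 (normalizedHam μ ω) z = 1 / 3 * libFreq μ ω z ^ 2 * z 1 ∧
      -partialD 0 (normalizedHam μ ω) z = 0) ∧
    (∀ z ∈ domain, ∀ γ : ℝ → Phase, γ 0 = z →
      ((∀ t : ℝ, HasDerivAt γ (hamVec (normalizedHam μ ω) (γ t)) t) ↔
        ∀ t : ℝ, γ t = solution μ ω z t)) := by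
  refine ⟨fun z hz => hillHam_eq_orderedHam hω hz, fun z _ => hasSum_orderedHam μ ω z,
    fun φ σ χ => ⟨S_zero φ σ χ, S_one φ σ χ, S_two φ σ χ⟩,
    ⟨normalizingGen μ ω, isNormalizing_normalizingGen μ hω⟩,
    fun W hW => ⟨fun z hz => ?_, fun z hz ε => newHam_eq hω hW hz ε,
      fun z₀ hz₀ i j => poisson_lieTransform_isBigO hW.smooth hW.low_order hz₀ i j,
      fun z₀ hz₀ => orderedHam_lieTransform_isBigO hω hW.smooth hW.low_order hz₀⟩,
    fun z hz => ⟨libFreq_pos hμ hω hz, normalizedHam_eq_libFreq hμ hω hz,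
      partialD_three_normalizedHam hω hz, ?_, ?_⟩, fun z hz γ h0 => ⟨fun h t => ?_, fun h t => ?_⟩⟩
  · rw [newHam_eq hω hW hz, normalizedHam]
    ring
  · rw [partialD_one_normalizedHam hμ hω hz, neg_neg]
  · rw [partialD_zero_normalizedHam, neg_zero]
  · exact orbit_unique hμ hω (h0.trans (solution_zero μ ω z).symm) (h0 ▸ hz) h
      (hasDerivAt_solution hμ hω hz) t
  · rw [funext h]
    exact hasDerivAt_solution hμ hω hz t
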